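/- Let $n\ge 2$, let $G=\mathrm{Spin}_e(n,1)$ and $K=\mathrm{Spin}(n)$ be the two-fold covers of $\mathrm{SO}_e(n,1)$ and $\mathrm{SO}(n)$, so that $G/K$ is the real hyperbolic space $\mathbb{H}^n$ of curvature $-1$, and let $G=K(\exp\mathfrak a)N$, $\mathfrak a\simeq\mathbb{R}$, be the Iwasawa decomposition, with $x\in K\exp(H(x))N$ for $x\in G$. Let $dx$ be a Haar measure on $G$, let $dk$ be the normalized Haar measure on $K$, and let $$\varphi_0(x)=\int_K e^{-\frac{n-1}{2}H(xk)}\,dk$$ be the ground spherical function. Let $\tau$ be a unitary representation of $K$ on a finite-dimensional complex Hilbert space $V$ (for instance the spin representation, or one of the half-spin representations if $n$ is even). For $1\le p\le\infty$ let $L^p(G,\tau)$ be the space of $L^p$ functions $f:G\to V$ with $f(xk)=\tau(k)^{-1}f(x)$ for all $x\in G$, $k\in K$ (the $L^p$ sections of the bundle $G\times_K V$). A function $\kappa:G\to\mathrm{End}\,V$ is $\tau$-radial if $\kappa(k_1xk_2)=\tau(k_2)^{-1}\kappa(x)\tau(k_1)^{-1}$ for all $x\in G$, $k_1,k_2\in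 K$. For $2\le q\le\infty$ let $\mathcal A_q(G,\tau,\tau)$ be the space of measurable $\tau$-radial functions $\kappa$ with $\|\kappa\|_{\mathcal A_q}<\infty$, where, with the operator norm on $\mathrm{End}\,V$, $$\|\kappa\|_{\mathcal A_q}=\Big(\int_G\|\kappa(x)\|^{\frac q2}\,\varphi_0(x)\,dx\Big)^{\frac2q}\quad(2\le q<\infty),\qquad \|\kappa\|_{\mathcal A_\infty}=\|\kappa\|_{L^\infty}.$$ Let $2\le q\le\infty$ and $\frac1q+\frac1{q'}=1$. Then $$L^{q'}(G,\tau)*\mathcal A_q(G,\tau,\tau)\subset L^q(G,\tau),$$ with the corresponding norm estimate. That is, there is a constant $C>0$ such that for all $F\in L^{q'}(G,\tau)$ and $\kappa\in\mathcal A_q(G,\tau,\tau)$ the integral $$(F*\kappa)(x)=\int_G\kappa(y^{-1}x)F(y)\,dy$$ converges absolutely for almost every $x\in G$, one has $F*\kappa\in L^q(G,\tau)$, and $$\|F*\kappa\|_{L^q(G,\tau)}\le C\,\|F\|_{L^{q'}(G,\tau)}\,\|\kappa\|_{\mathcal A_q}.$$ -/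

import Mathlib

open MeasureTheory
open scoped ENNReal

noncomputable section

namespace SpinHyperbolic

/-- The quadratic form `x₁² + ⋯ + xₙ² - xₙ₊₁²` on `ℝⁿ⁺¹`; the last coordinate is the
timelike one. -/
def lorentzForm (n : ℕ) : QuadraticForm ℝ (Fin (n + 1) → ℝ) :=
  QuadraticMap.weightedSumSquares ℝ (fun i : Fin (n + 1) => if i = Fin.last n then (-1 : ℝ) else 1)

/-- The real Clifford algebra `Cl(n, 1)`, in which `v * v = lorentzForm n v` for vectors `v`. -/
abbrev Cl (n : ℕ) : Type := CliffordAlgebra (lorentzForm n)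

/-- The Clifford algebra carries its canonical topology as a (finite dimensional) real vector
space. -/
instance instTopologicalSpaceCl (n : ℕ) : TopologicalSpace (Cl n) := moduleTopology ℝ (Cl n)

instance instIsModuleTopologyCl (n : ℕ) : IsModuleTopology ℝ (Cl n) := ⟨rfl⟩

instance instMeasurableSpaceCl (n : ℕ) : MeasurableSpace (Cl n) := borel (Cl n)

instance instBorelSpaceCl (n : ℕ) : BorelSpace (Cl n) := ⟨rfl⟩

/-- The group `G = Spin_e(n, 1)`, with the topology and the Borel structure it inherits from the
Clifford algebra.

An element of Mathlib's `spinGroup` is a product `v₁ ⋯ v₂ₖ` of an even number of non-isotropic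
vectors with `Q(v₁) ⋯ Q(v₂ₖ) = 1`.  So evenly many of the `vᵢ` are timelike, and acting on
`ℝⁿ⁺¹` by conjugation the group is the two-fold cover of the identity component `SO_e(n, 1)`. -/
abbrev G (n : ℕ) : Type := ↥(spinGroup (lorentzForm n))

/-- The standard basis vector of `ℝⁿ⁺¹` with index `i`, as an element of the Clifford algebra. -/
def e (n : ℕ) (i : Fin (n + 1)) : Cl n :=
  CliffordAlgebra.ι (lorentzForm n) (Pi.single i 1)

/-- The maximal compact subgroup `K = Spin(n)` of `G`: the elements whose conjugation action on
`ℝⁿ⁺¹` fixes the timelike basis vector (the origin of hyperbolic space), that is, the preimage of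
`SO(n)` in the two-fold cover `G` of `SO_e(n, 1)`. -/
def K (n : ℕ) : Subgroup (G n) where
  carrier := {g | (g : Cl n) * e n (Fin.last n) = e n (Fin.last n) * (g : Cl n)}
  one_mem' := by simp
  mul_mem' := by
    intro a b ha hb
    have ha' : (a : Cl n) * e n (Fin.last n) = e n (Fin.last n) * (a : Cl n) := ha
    have hb' : (b : Cl n) * e n (Fin.last n) = e n (Fin.last n) * (b : Cl n) := hb
    change ((a : Cl n) * (b : Cl n)) * e n (Fin.last n)
      = e n (Fin.last n) * ((a : Cl n) * (b : Cl n))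
    rw [mul_assoc, hb', ← mul_assoc, ha', mul_assoc]
  inv_mem' := by
    intro a ha
    have ha' : (a : Cl n) * e n (Fin.last n) = e n (Fin.last n) * (a : Cl n) := ha
    have h1 : ((a⁻¹ : G n) : Cl n) * (a : Cl n) = 1 :=
      congrArg (Subtype.val : G n → Cl n) (inv_mul_cancel a)
    have h2 : (a : Cl n) * ((a⁻¹ : G n) : Cl n) = 1 :=
      congrArg (Subtype.val : G n → Cl n) (mul_inv_cancel a)
    change ((a⁻¹ : G n) : Cl n) * e n (Fin.last n) = e n (Fin.last n) * ((a⁻¹ : G n) : Cl n)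
    calc ((a⁻¹ : G n) : Cl n) * e n (Fin.last n)
        = ((a⁻¹ : G n) : Cl n) * e n (Fin.last n) * ((a : Cl n) * ((a⁻¹ : G n) : Cl n)) := by
          rw [h2, mul_one]
      _ = ((a⁻¹ : G n) : Cl n) * (e n (Fin.last n) * (a : Cl n)) * ((a⁻¹ : G n) : Cl n) := by
          simp only [mul_assoc]
      _ = (((a⁻¹ : G n) : Cl n) * (a : Cl n)) * e n (Fin.last n) * ((a⁻¹ : G n) : Cl n) := by
          rw [← ha']; simp only [mul_assoc]
      _ = e n (Fin.last n) * ((a⁻¹ : G n) : Cl n) := by rw [h1, one_mul]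

/-- The one-parameter group `exp 𝔞`, parametrised by `𝔞 ≃ ℝ`: the exponential
`exp ((r / 2) eₙ₊₁ e₁) = cosh (r / 2) + sinh (r / 2) eₙ₊₁ e₁` (note `(eₙ₊₁ e₁)² = 1`).  It acts on
`ℝⁿ⁺¹` as the boost `eₙ₊₁ ↦ cosh r eₙ₊₁ + sinh r e₁`, so it moves the origin of hyperbolic space at
unit speed (for curvature `-1`). -/
def expA (n : ℕ) (r : ℝ) : Cl n :=
  algebraMap ℝ (Cl n) (Real.cosh (r / 2))
    + algebraMap ℝ (Cl n) (Real.sinh (r / 2)) * (e n (Fin.last n) * e n 0)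

/-- The elements of the nilpotent group `N` of the Iwasawa decomposition, parametrised by the
vectors `v` orthogonal to `e₁` and `eₙ₊₁`: with the isotropic vector `ξ = e₁ + eₙ₊₁` one has
`exp (ξ v) = 1 + ξ v`, since `(ξ v)² = 0`.  As `exp 𝔞` conjugates `ξ v` to `eʳ ξ v`, the `ξ v`
span the root space of the positive root. -/
def expN (n : ℕ) (v : Fin (n + 1) → ℝ) : Cl n :=
  1 + (e n 0 + e n (Fin.last n)) * CliffordAlgebra.ι (lorentzForm n) v

/-- `r` is the `𝔞`-component of `g` in the Iwasawa decomposition `G = K (exp 𝔞) N`. -/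
def IsIwasawa (n : ℕ) (g : G n) (r : ℝ) : Prop :=
  ∃ k ∈ K n, ∃ v : Fin (n + 1) → ℝ, v 0 = 0 ∧ v (Fin.last n) = 0 ∧
    (g : Cl n) = (k : Cl n) * expA n r * expN n v

/-- The Iwasawa projection `H : G → 𝔞 ≃ ℝ`: `g ∈ K exp(H(g)) N`. -/
def H (n : ℕ) (g : G n) : ℝ := Classical.epsilon (IsIwasawa n g)

/-- The ground spherical function `φ₀(x) = ∫_K exp(-((n - 1) / 2) H(x k)) dk`, where `ν` is the
normalized Haar measure of `K`. -/
def phi0 (n : ℕ) (ν : Measure (K n)) (x : G n) : ℝ :=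
  ∫ k : K n, Real.exp (-(((n : ℝ) - 1) / 2) * H n (x * (k : G n))) ∂ν

section Spaces

variable {V : Type*} [NormedAddCommGroup V] [InnerProductSpace ℂ V]

/-- Functions of type `τ`, i.e. sections of the homogeneous bundle `G ×_K V`:
`f (x k) = τ(k)⁻¹ f(x)`. -/
def IsTauType {n : ℕ} (τ : K n →* (V ≃ₗᵢ[ℂ] V)) (f : G n → V) : Prop :=
  ∀ (x : G n) (k : K n), f (x * (k : G n)) = (τ k)⁻¹ (f x)

/-- `τ`-radial functions: `κ (k₁ x k₂) = τ(k₂)⁻¹ κ(x) τ(k₁)⁻¹` in `End V`. -/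
def IsTauRadial {n : ℕ} (τ : K n →* (V ≃ₗᵢ[ℂ] V)) (κ : G n → (V →L[ℂ] V)) : Prop :=
  ∀ (x : G n) (k₁ k₂ : K n) (w : V),
    κ ((k₁ : G n) * x * (k₂ : G n)) w = (τ k₂)⁻¹ (κ x ((τ k₁)⁻¹ w))

/-- The space `L^p(G, τ)` of `L^p` functions of type `τ`. -/
def MemLpTau {n : ℕ} (τ : K n →* (V ≃ₗᵢ[ℂ] V)) (μ : Measure (G n)) (p : ℝ≥0∞)
    (f : G n → V) : Prop :=
  IsTauType τ f ∧ MemLp f p μ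

/-- The norm of `𝒜_q(G, τ, τ)`: the `L^∞` norm if `q = ∞`, and
`(∫_G ‖κ(x)‖^(q/2) φ₀(x) dx)^(2/q)` if `q < ∞`, with values in `[0, ∞]`. -/
def normA {n : ℕ} (μ : Measure (G n)) (ν : Measure (K n)) (q : ℝ≥0∞)
    (κ : G n → (V →L[ℂ] V)) : ℝ≥0∞ :=
  if q = ∞ then eLpNorm κ ∞ μ
  else (∫⁻ x, ‖κ x‖ₑ ^ (q.toReal / 2) * ENNReal.ofReal (phi0 n ν x) ∂μ) ^ (2 / q.toReal)

/-- The space `𝒜_q(G, τ, τ)` of `τ`-radial functions of finite `𝒜_q` norm. -/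
def MemA {n : ℕ} (τ : K n →* (V ≃ₗᵢ[ℂ] V)) (μ : Measure (G n)) (ν : Measure (K n)) (q : ℝ≥0∞)
    (κ : G n → (V →L[ℂ] V)) : Prop :=
  IsTauRadial τ κ ∧ AEStronglyMeasurable κ μ ∧ normA μ ν q κ < ∞

/-- The convolution `(F * κ)(x) = ∫_G κ(y⁻¹ x) F(y) dy`. -/
def conv {n : ℕ} (μ : Measure (G n)) (F : G n → V) (κ : G n → (V →L[ℂ] V)) (x : G n) : V :=
  ∫ y, κ (y⁻¹ * x) (F y) ∂μ

end Spaces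

end SpinHyperbolic

end

/-!
Since `τ` is unitary, `k = ‖κ‖` is bi-invariant under `K`, and `‖F * κ‖` is dominated by the scalar
convolution `f * k` with `f = ‖F‖`. The estimate for `f * k` holds with constant `1`.

*The case `q = 2`* is Herz's principle (`lintegral_conv_sq_le`). Put `ρ = (n - 1) / 2`. The function
`w(x) = exp (-ρ H(x⁻¹))` satisfies `∫ k(y⁻¹ x) w(y) dy = A w(x)` and `∫ k(y⁻¹ x) w(x) dx = A w(y)`
with `A = ∫ k φ₀`, so Schur's test with the weight `w` bounds `f ↦ f * k` on `L²` by `A`. The two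
identities follow from the cocycle property of `H` (`height_mul`), by a translation of the
integration variable by an element of `K` and an average over `K` (`lintegral_inv_mul_expRhoH`).
They have the same constant because `x⁻¹ ∈ K x K` (`exists_inv_eq_mul_mul`), so that bi-invariant
functions, such as `k` and `φ₀`, are even. This also makes unimodularity of `G` unnecessary.

*The case `2 < q < ∞`* follows by Hölder's inequality (`lintegral_rpow_le_of_holder`), from
`f k = (f ^ (q' / 2) k ^ (q / 2)) ^ (2 / q) (f ^ q') ^ (1 - 2 / q)` and the case `q = 2` for
`f ^ (q' / 2)` and `k ^ (q / 2)`. The case `q = ∞` is trivial.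

*The group theory* takes place in the Clifford algebra. A spinor norm argument shows that `G`
preserves the time orientation (`exists_spinorNorm`), which gives the Iwasawa decomposition
(`exists_iwasawa`) and the formula `exp (H g) = -⟨g ξ, eₙ₊₁⟩` for the isotropic vector
`ξ = e₁ + eₙ₊₁` (`exp_H`). Products of two reflections show that `K` is transitive on spheres, whence
`x⁻¹ ∈ K x K`. To use Tonelli's theorem the Haar measure of `G` has to be `σ`-finite, so `G` has to be
`σ`-compact; as `G = K (exp 𝔞) N`, it suffices that `K` is compact. By the Cartan-Dieudonné
reduction, and since the twisted centre of the Clifford algebra consists of scalars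
(`exists_smul_one_of_involute_mul`), every element of `K` is up to sign a product of `n` factors, each
a spatial unit vector or `1`.
-/

open MeasureTheory
open scoped ENNReal

noncomputable section

namespace SpinHyperbolic

open CliffordAlgebra

/-! ### The Lorentz form and the Clifford relations -/

/-- The Lorentz bilinear form `∑_{i<n} uᵢ vᵢ - uₙ vₙ` (coordinates indexed from `0`)
polarising `lorentzForm n`. -/
def lorentzInner {n : ℕ} (u v : Fin (n + 1) → ℝ) : ℝ :=
  ∑ i : Fin n, u i.castSucc * v i.castSucc - u (Fin.last n) * v (Fin.last n)

variable {n : ℕ}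

lemma lorentzForm_eq (v : Fin (n + 1) → ℝ) : lorentzForm n v = lorentzInner v v := by
  simp [lorentzForm, lorentzInner, QuadraticMap.weightedSumSquares_apply, Fin.sum_univ_castSucc,
    Fin.castSucc_ne_last, sub_eq_add_neg]

lemma lorentzInner_comm (u v : Fin (n + 1) → ℝ) : lorentzInner u v = lorentzInner v u := by
  simp [lorentzInner, mul_comm]

lemma lorentzInner_add_left (u v w : Fin (n + 1) → ℝ) :
    lorentzInner (u + v) w = lorentzInner u w + lorentzInner v w := by
  simp only [lorentzInner, Pi.add_apply, add_mul, Finset.sum_add_distrib]; ring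

lemma lorentzInner_smul_left (c : ℝ) (u v : Fin (n + 1) → ℝ) :
    lorentzInner (c • u) v = c * lorentzInner u v := by
  simp only [lorentzInner, Pi.smul_apply, smul_eq_mul, mul_assoc, ← Finset.mul_sum]; ring

lemma lorentzInner_add_right (u v w : Fin (n + 1) → ℝ) :
    lorentzInner u (v + w) = lorentzInner u v + lorentzInner u w := by
  rw [lorentzInner_comm, lorentzInner_add_left, lorentzInner_comm v, lorentzInner_comm w]

lemma lorentzInner_smul_right (c : ℝ) (u v : Fin (n + 1) → ℝ) :
    lorentzInner u (c • v) = c * lorentzInner u v := by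
  rw [lorentzInner_comm, lorentzInner_smul_left, lorentzInner_comm]

lemma lorentzInner_sub_right (u v w : Fin (n + 1) → ℝ) :
    lorentzInner u (v - w) = lorentzInner u v - lorentzInner u w := by
  rw [sub_eq_add_neg, ← neg_one_smul ℝ w, lorentzInner_add_right, lorentzInner_smul_right]; ring

lemma lorentzInner_sub_left (u v w : Fin (n + 1) → ℝ) :
    lorentzInner (u - v) w = lorentzInner u w - lorentzInner v w := by
  rw [lorentzInner_comm, lorentzInner_sub_right, lorentzInner_comm u, lorentzInner_comm v]

/-- The inclusion of `ℝⁿ⁺¹` in the Clifford algebra `Cl n`. -/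
abbrev vec (v : Fin (n + 1) → ℝ) : Cl n := ι (lorentzForm n) v

lemma vec_add (u v : Fin (n + 1) → ℝ) : vec (u + v) = vec u + vec v := map_add _ u v

lemma vec_sub (u v : Fin (n + 1) → ℝ) : vec (u - v) = vec u - vec v := map_sub _ u v

lemma vec_smul (c : ℝ) (v : Fin (n + 1) → ℝ) : vec (c • v) = c • vec v := map_smul _ c v

lemma vec_mul_self (v : Fin (n + 1) → ℝ) : vec v * vec v = lorentzInner v v • (1 : Cl n) := by
  rw [ι_sq_scalar, lorentzForm_eq, Algebra.algebraMap_eq_smul_one]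

lemma vec_mul_add_swap (u v : Fin (n + 1) → ℝ) :
    vec u * vec v + vec v * vec u = (2 * lorentzInner u v) • (1 : Cl n) := by
  have h := vec_mul_self (u + v)
  rw [vec_add, mul_add, add_mul, add_mul, vec_mul_self, vec_mul_self, lorentzInner_add_left,
    lorentzInner_add_right, lorentzInner_add_right, lorentzInner_comm v u] at h
  linear_combination (norm := module) h

lemma vec_mul_swap (u v : Fin (n + 1) → ℝ) :
    vec u * vec v = (2 * lorentzInner u v) • (1 : Cl n) - vec v * vec u := by
  rw [← vec_mul_add_swap]; abel

instance instInvertibleTwoReal : Invertible (2 : ℝ) := invertibleOfNonzero two_ne_zero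

instance instNontrivialCl : Nontrivial (Cl n) :=
  (equivExterior (lorentzForm n)).symm.injective.nontrivial

lemma vec_injective : Function.Injective (vec : (Fin (n + 1) → ℝ) → Cl n) := by
  intro u v h
  have := congrArg (equivExterior (lorentzForm n)) h
  simpa [vec, equivExterior, changeFormEquiv] using this

lemma smul_one_injective {a b : ℝ} (h : a • (1 : Cl n) = b • (1 : Cl n)) : a = b :=
  smul_left_injective ℝ (one_ne_zero : (1 : Cl n) ≠ 0) h

/-- The standard basis vector of `ℝⁿ⁺¹` with index `i`. -/
abbrev basisVec (i : Fin (n + 1)) : Fin (n + 1) → ℝ := Pi.single i 1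

lemma vec_basisVec (i : Fin (n + 1)) : vec (basisVec i) = e n i := rfl

lemma lorentzInner_basisVec_castSucc (i : Fin n) (v : Fin (n + 1) → ℝ) :
    lorentzInner (basisVec i.castSucc) v = v i.castSucc := by
  simp [lorentzInner, Pi.single_apply, (Fin.castSucc_ne_last _).symm]

lemma lorentzInner_basisVec_last (v : Fin (n + 1) → ℝ) :
    lorentzInner (basisVec (Fin.last n)) v = - v (Fin.last n) := by
  simp [lorentzInner, Fin.castSucc_ne_last]

lemma lorentzInner_basisVec_of_ne {i j : Fin (n + 1)} (h : i ≠ j) :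
    lorentzInner (basisVec i) (basisVec j) = 0 := by
  induction i using Fin.lastCases with
  | last => rw [lorentzInner_basisVec_last]; simp [h]
  | cast i => rw [lorentzInner_basisVec_castSucc]; simp [h]

lemma lorentzInner_basisVec_self_ne_zero (i : Fin (n + 1)) :
    lorentzInner (basisVec i) (basisVec i) ≠ 0 := by
  induction i using Fin.lastCases with
  | last => rw [lorentzInner_basisVec_last]; simp
  | cast i => rw [lorentzInner_basisVec_castSucc]; simp

lemma e_mul_self (i : Fin (n + 1)) :
    e n i * e n i = lorentzInner (basisVec i) (basisVec i) • (1 : Cl n) := vec_mul_self _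

lemma e_mul_e_of_ne {i j : Fin (n + 1)} (h : i ≠ j) : e n i * e n j = -(e n j * e n i) := by
  rw [← vec_basisVec, ← vec_basisVec, vec_mul_swap, lorentzInner_basisVec_of_ne h]; simp

/-! ### Coordinate subalgebras and the twisted centre -/

/-- The subalgebra of `Cl n` generated by the basis vectors with index in `S`. -/
def coordSubalgebra (S : Set (Fin (n + 1))) : Subalgebra ℝ (Cl n) := Algebra.adjoin ℝ (e n '' S)

lemma involute_mem_coordSubalgebra {S : Set (Fin (n + 1))} {i : Fin (n + 1)} (hi : i ∉ S)
    {b : Cl n} (hb : b ∈ coordSubalgebra S) :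
    involute b ∈ coordSubalgebra S ∧ b * e n i = e n i * involute b := by
  induction hb using Algebra.adjoin_induction with
  | mem x hx =>
    obtain ⟨j, hj, rfl⟩ := hx
    have h1 : involute (e n j) = - e n j := involute_ι _
    rw [h1]
    refine ⟨neg_mem (Algebra.subset_adjoin ⟨j, hj, rfl⟩), ?_⟩
    rw [e_mul_e_of_ne (by rintro rfl; exact hi hj), mul_neg]
  | algebraMap r =>
    rw [AlgHom.commutes]
    exact ⟨Subalgebra.algebraMap_mem _ r, Algebra.commutes r _⟩
  | add x y _ _ hx hy =>
    rw [map_add]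
    exact ⟨add_mem hx.1 hy.1, by rw [add_mul, hx.2, hy.2, mul_add]⟩
  | mul x y _ _ hx hy =>
    rw [map_mul]
    exact ⟨mul_mem hx.1 hy.1, by rw [mul_assoc, hy.2, ← mul_assoc, hx.2, mul_assoc]⟩

lemma exists_eq_add_e_mul {S : Set (Fin (n + 1))} {i : Fin (n + 1)} (hi : i ∉ S)
    {x : Cl n} (hx : x ∈ coordSubalgebra (insert i S)) :
    ∃ b ∈ coordSubalgebra S, ∃ c ∈ coordSubalgebra S, x = b + e n i * c := by
  induction hx using Algebra.adjoin_induction with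
  | mem x hx =>
    obtain ⟨j, hj, rfl⟩ := hx
    rcases hj with rfl | hj
    · exact ⟨0, zero_mem _, 1, one_mem _, by simp⟩
    · exact ⟨e n j, Algebra.subset_adjoin ⟨j, hj, rfl⟩, 0, zero_mem _, by simp⟩
  | algebraMap r => exact ⟨_, Subalgebra.algebraMap_mem _ r, 0, zero_mem _, by simp⟩
  | add x y _ _ hx hy =>
    obtain ⟨b, hb, c, hc, rfl⟩ := hx
    obtain ⟨b', hb', c', hc', rfl⟩ := hy
    exact ⟨b + b', add_mem hb hb', c + c', add_mem hc hc', by rw [mul_add]; abel⟩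
  | mul x y _ _ hx hy =>
    obtain ⟨b, hb, c, hc, rfl⟩ := hx
    obtain ⟨b', hb', c', hc', rfl⟩ := hy
    obtain ⟨hb1, hb2⟩ := involute_mem_coordSubalgebra hi hb
    obtain ⟨hc1, hc2⟩ := involute_mem_coordSubalgebra hi hc
    refine ⟨b * b' + lorentzInner (basisVec i) (basisVec i) • (involute c * c'),
      add_mem (mul_mem hb hb') (Subalgebra.smul_mem _ (mul_mem hc1 hc') _),
      involute b * c' + c * b', add_mem (mul_mem hb1 hc') (mul_mem hc hb'), ?_⟩
    have h1 : b * (e n i * c') = e n i * (involute b * c') := by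
      rw [← mul_assoc, hb2, mul_assoc]
    have h2 : e n i * c * (e n i * c')
        = lorentzInner (basisVec i) (basisVec i) • (involute c * c') := by
      rw [mul_assoc, ← mul_assoc c, hc2, mul_assoc, ← mul_assoc, e_mul_self, smul_one_mul]
    rw [add_mul, mul_add, mul_add, h1, h2, mul_add, mul_assoc]
    abel

lemma vec_eq_sum (v : Fin (n + 1) → ℝ) : vec v = ∑ i, v i • e n i := by
  conv_lhs => rw [← Finset.univ_sum_single v, vec, map_sum]
  refine Finset.sum_congr rfl fun i _ => ?_
  rw [e, ← map_smul, ← Pi.single_smul, smul_eq_mul, mul_one]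

lemma coordSubalgebra_univ : coordSubalgebra (Set.univ : Set (Fin (n + 1))) = ⊤ := by
  rw [eq_top_iff, ← adjoin_range_ι]
  refine Algebra.adjoin_le ?_
  rintro _ ⟨v, rfl⟩
  change vec v ∈ _
  rw [vec_eq_sum]
  exact sum_mem fun i _ => Subalgebra.smul_mem _
    (Algebra.subset_adjoin (Set.mem_image_of_mem _ (Set.mem_univ i))) _

lemma fg_coordSubalgebra (S : Finset (Fin (n + 1))) :
    (Subalgebra.toSubmodule (coordSubalgebra (S : Set (Fin (n + 1))))).FG := by
  induction S using Finset.induction_on with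
  | empty =>
    rw [coordSubalgebra, Finset.coe_empty, Set.image_empty, Algebra.adjoin_empty]
    exact Subalgebra.fg_bot_toSubmodule
  | insert i S hi ih =>
    have h := ih.sup (ih.map (LinearMap.mulLeft ℝ (e n i)))
    have := Module.Finite.iff_fg.2 h
    refine Module.Finite.iff_fg.1 (Submodule.finiteDimensional_of_le
      (S₂ := Subalgebra.toSubmodule (coordSubalgebra (S : Set (Fin (n + 1)))) ⊔ (Subalgebra.toSubmodule
        (coordSubalgebra (S : Set (Fin (n + 1))))).map (LinearMap.mulLeft ℝ (e n i))) ?_)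
    intro x hx
    rw [Finset.coe_insert] at hx
    obtain ⟨b, hb, c, hc, rfl⟩ := exists_eq_add_e_mul (by simpa using hi) hx
    exact Submodule.add_mem_sup hb ⟨c, hc, rfl⟩

instance instFiniteDimensionalCl : FiniteDimensional ℝ (Cl n) := by
  have h := fg_coordSubalgebra (n := n) Finset.univ
  rw [Finset.coe_univ, coordSubalgebra_univ, Algebra.top_toSubmodule] at h
  exact Module.finite_def.2 h

/-- The twisted centre of the Clifford algebra consists of scalars: each generator `eᵢ` is removed
in turn from the expression of `x`. -/
lemma exists_smul_one_of_involute_mul {x : Cl n}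
    (hx : ∀ i, involute x * e n i = e n i * x) : ∃ c : ℝ, x = c • (1 : Cl n) := by
  have key : ∀ S : Finset (Fin (n + 1)), x ∈ coordSubalgebra ((S : Set (Fin (n + 1)))ᶜ) := by
    intro S
    induction S using Finset.induction_on with
    | empty => rw [Finset.coe_empty, Set.compl_empty, coordSubalgebra_univ]; trivial
    | insert i S hi ih =>
      have h1 : ((S : Set (Fin (n + 1)))ᶜ) = insert i ((insert i S : Finset _) : Set _)ᶜ := by
        ext j; by_cases hj : j = i <;> simp [hj, hi]
      have hi' : i ∉ (((insert i S : Finset _) : Set (Fin (n + 1))))ᶜ := by simp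
      rw [h1] at ih
      obtain ⟨b, hb, c, hc, rfl⟩ := exists_eq_add_e_mul hi' ih
      obtain ⟨hb1, -⟩ := involute_mem_coordSubalgebra hi' hb
      obtain ⟨hc1, -⟩ := involute_mem_coordSubalgebra hi' hc
      have hb2 := (involute_mem_coordSubalgebra hi' hb1).2
      have hc2 := (involute_mem_coordSubalgebra hi' hc1).2
      rw [involute_involute] at hb2 hc2
      have h2 := hx i
      have h3 : involute (e n i) = - e n i := involute_ι _
      rw [map_add, map_mul, h3, add_mul, mul_assoc, hc2, hb2, mul_add, add_right_inj, neg_mul,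
        ← mul_assoc, e_mul_self, smul_one_mul, neg_eq_iff_add_eq_zero, ← two_smul ℝ, smul_smul] at h2
      have h4 : c = 0 := (smul_eq_zero.1 h2).resolve_left
        (mul_ne_zero two_ne_zero (lorentzInner_basisVec_self_ne_zero i))
      rw [h4, mul_zero, add_zero]
      exact hb
  have h := key Finset.univ
  rw [Finset.coe_univ, Set.compl_univ, coordSubalgebra, Set.image_empty, Algebra.adjoin_empty,
    Algebra.mem_bot] at h
  obtain ⟨c, rfl⟩ := h
  exact ⟨c, Algebra.algebraMap_eq_smul_one c⟩

/-! ### Topology of the Clifford algebra and of the spin group -/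

instance instIsTopologicalRingCl : IsTopologicalRing (Cl n) :=
  IsModuleTopology.isTopologicalRing ℝ (Cl n)

instance instContinuousSMulCl : ContinuousSMul ℝ (Cl n) := IsModuleTopology.toContinuousSMul ℝ (Cl n)

/-- Coordinates with respect to a basis, as a homeomorphism. -/
def homeomorphCl : Cl n ≃ₜ (Fin (Module.finrank ℝ (Cl n)) → ℝ) where
  toEquiv := (Module.finBasis ℝ (Cl n)).equivFun.toEquiv
  continuous_toFun :=
    IsModuleTopology.continuous_of_linearMap (Module.finBasis ℝ (Cl n)).equivFun.toLinearMap
  continuous_invFun :=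
    IsModuleTopology.continuous_of_linearMap (Module.finBasis ℝ (Cl n)).equivFun.symm.toLinearMap

instance instT2SpaceCl : T2Space (Cl n) := homeomorphCl.symm.t2Space

instance instSecondCountableCl : SecondCountableTopology (Cl n) :=
  homeomorphCl.secondCountableTopology

lemma continuous_star_Cl : Continuous (star : Cl n → Cl n) :=
  IsModuleTopology.continuous_of_linearMap
    ((reverse (Q := lorentzForm n)).comp (involute (Q := lorentzForm n)).toLinearMap)

instance instIsTopologicalGroupG : IsTopologicalGroup (G n) where
  continuous_mul := by
    refine Continuous.subtype_mk ?_ _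
    exact (continuous_subtype_val.comp continuous_fst).mul
      (continuous_subtype_val.comp continuous_snd)
  continuous_inv := by
    refine Continuous.subtype_mk ?_ _
    exact continuous_star_Cl.comp continuous_subtype_val

instance instBorelSpaceG : BorelSpace (G n) := Subtype.borelSpace _

lemma coe_mul_coe_inv (g : G n) : (g : Cl n) * ((g⁻¹ : G n) : Cl n) = 1 :=
  congrArg (Subtype.val : G n → Cl n) (mul_inv_cancel g)

lemma coe_inv_eq_reverse (g : G n) : ((g⁻¹ : G n) : Cl n) = reverse (g : Cl n) := by
  change star (g : Cl n) = _
  rw [star_def, spinGroup.involute_eq g.2]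

/-! ### Products of vectors and the Lipschitz group -/

/-- The products of invertible vectors: the Lipschitz group, as a submonoid of the Clifford
algebra. -/
abbrev lipschitz (n : ℕ) : Submonoid (Cl n) :=
  (lipschitzGroup (lorentzForm n)).toSubmonoid.map (Units.coeHom (Cl n))

/-- A non-isotropic vector as a unit of the Clifford algebra. -/
def vecUnit (u : Fin (n + 1) → ℝ) (hu : lorentzInner u u ≠ 0) : (Cl n)ˣ where
  val := vec u
  inv := (lorentzInner u u)⁻¹ • vec u
  val_inv := by rw [mul_smul_comm, vec_mul_self, smul_smul, inv_mul_cancel₀ hu, one_smul]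
  inv_val := by rw [smul_mul_assoc, vec_mul_self, smul_smul, inv_mul_cancel₀ hu, one_smul]

lemma vec_mem_lipschitz {u : Fin (n + 1) → ℝ} (hu : lorentzInner u u ≠ 0) :
    vec u ∈ lipschitz n :=
  ⟨vecUnit u hu, Subgroup.subset_closure ⟨u, rfl⟩, rfl⟩

lemma vec_mul_vec_mem_even (u v : Fin (n + 1) → ℝ) :
    vec u * vec v ∈ CliffordAlgebra.even (lorentzForm n) :=
  ι_mul_ι_mem_evenOdd_zero _ u v

lemma mem_spinGroup {x : Cl n} (h1 : x ∈ lipschitz n)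
    (h2 : x ∈ CliffordAlgebra.even (lorentzForm n)) (h3 : x * reverse x = 1) :
    x ∈ spinGroup (lorentzForm n) := by
  have h4 : star x = reverse x := by rw [star_def, involute_eq_of_mem_even h2]
  refine ⟨⟨h1, ?_, ?_⟩, h2⟩
  · obtain ⟨u, -, rfl⟩ := h1
    rw [h4, show reverse (Units.coeHom (Cl n) u) = ((u⁻¹ : (Cl n)ˣ) : Cl n) from
      (Units.inv_eq_of_mul_eq_one_right h3).symm]
    exact Units.inv_mul u
  · rw [h4]; exact h3

lemma reverse_vec (u : Fin (n + 1) → ℝ) : reverse (vec u) = vec u := reverse_ι u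

lemma involute_vec (u : Fin (n + 1) → ℝ) : involute (vec u) = - vec u := involute_ι u

lemma vec_mul_vec_mul_reverse (u v : Fin (n + 1) → ℝ) :
    vec u * vec v * reverse (vec u * vec v)
      = (lorentzInner u u * lorentzInner v v) • (1 : Cl n) := by
  rw [reverse.map_mul, reverse_vec, reverse_vec, mul_assoc, ← mul_assoc (vec v), vec_mul_self,
    smul_one_mul, mul_smul_comm, vec_mul_self, smul_smul, mul_comm]

/-- The product of two vectors with `Q(u) Q(v) = 1`, as an element of the spin group. -/
def rotor (u v : Fin (n + 1) → ℝ) (h : lorentzInner u u * lorentzInner v v = 1) : G n :=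
  ⟨vec u * vec v, mem_spinGroup
    (mul_mem (vec_mem_lipschitz (left_ne_zero_of_mul_eq_one h))
      (vec_mem_lipschitz (right_ne_zero_of_mul_eq_one h)))
    (vec_mul_vec_mem_even u v) (by rw [vec_mul_vec_mul_reverse, h, one_smul])⟩

/-- The reflection in the hyperplane orthogonal to the non-isotropic vector `u`. -/
def reflect (u v : Fin (n + 1) → ℝ) : Fin (n + 1) → ℝ :=
  v - (2 * lorentzInner u v / lorentzInner u u) • u

lemma neg_vec_mul_vec {u : Fin (n + 1) → ℝ} (hu : lorentzInner u u ≠ 0) (v : Fin (n + 1) → ℝ) :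
    -(vec u * vec v) = vec (reflect u v) * vec u := by
  rw [reflect, vec_sub, vec_smul, sub_mul, smul_mul_assoc, vec_mul_self, vec_mul_swap v u,
    lorentzInner_comm v u, smul_smul, div_mul_cancel₀ _ hu]
  abel

/-- If twisted conjugation by an invertible element takes a vector to a vector, the two vectors
have the same norm. -/
lemma lorentzInner_eq_of_involute_mul {x y : Cl n} (hxy : x * y = 1)
    {v v' : Fin (n + 1) → ℝ} (h : involute x * vec v = vec v' * x) :
    lorentzInner v' v' = lorentzInner v v := by
  have h2 : x * vec v = vec v' * involute x := by
    have := congrArg involute h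
    rw [map_mul, map_mul, involute_involute, involute_vec, involute_vec, mul_neg, neg_mul,
      neg_inj] at this
    exact this
  have h3 : vec v' * vec v' * x = x * vec v * vec v := by
    rw [h2, mul_assoc, mul_assoc, ← h]
  rw [vec_mul_self, mul_assoc x, vec_mul_self, smul_one_mul, mul_smul_comm, mul_one] at h3
  have h4 := congrArg (· * y) h3
  simp only [smul_mul_assoc, hxy] at h4
  exact smul_one_injective h4

/-- A future-directed timelike vector. -/
def IsFuture (v : Fin (n + 1) → ℝ) : Prop := lorentzInner v v < 0 ∧ 0 < v (Fin.last n)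

/-- Reflection in `u` preserves or reverses the time orientation according to the sign
of `Q(u)`. -/
lemma IsFuture.reflection_pos {v : Fin (n + 1) → ℝ} (hv : IsFuture v)
    {u : Fin (n + 1) → ℝ} (hu : lorentzInner u u ≠ 0) :
    0 < lorentzInner u u * reflect u v (Fin.last n) := by
  obtain ⟨h1, h2⟩ := hv
  have hcs := Finset.sum_mul_sq_le_sq_mul_sq Finset.univ
    (fun i : Fin n => u i.castSucc) (fun i : Fin n => v i.castSucc)
  rw [reflect, Pi.sub_apply, Pi.smul_apply, smul_eq_mul, mul_sub, ← mul_assoc, mul_div_cancel₀ _ hu]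
  simp only [lorentzInner, ← sq] at *
  set A := ∑ i : Fin n, u i.castSucc ^ 2
  set B := ∑ i : Fin n, v i.castSucc ^ 2
  set D := ∑ i : Fin n, u i.castSucc * v i.castSucc
  set s := u (Fin.last n)
  set t := v (Fin.last n)
  have hA : 0 ≤ A := Finset.sum_nonneg fun i _ => sq_nonneg _
  have hB : 0 ≤ B := Finset.sum_nonneg fun i _ => sq_nonneg _
  have hAs : 0 < A + s ^ 2 := by
    rcases hA.lt_or_eq with h | h
    · positivity
    · rw [← h, zero_sub, neg_ne_zero] at hu
      rw [← h]; positivity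
  -- it suffices that `2 s D < (A + s²) t`, which follows from Cauchy-Schwarz
  have h3 : (2 * s * D) ^ 2 < ((A + s ^ 2) * t) ^ 2 := by
    have e1 : (2 * s * D) ^ 2 ≤ 4 * s ^ 2 * (A * B) := by
      have := mul_le_mul_of_nonneg_left hcs (by positivity : 0 ≤ 4 * s ^ 2)
      nlinarith
    have e2 : 4 * s ^ 2 * (A * B) ≤ (A + s ^ 2) ^ 2 * B := by
      nlinarith [mul_nonneg (sq_nonneg (A - s ^ 2)) hB]
    have e3 : (A + s ^ 2) ^ 2 * B < (A + s ^ 2) ^ 2 * t ^ 2 :=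
      mul_lt_mul_of_pos_left (by linarith) (by positivity)
    nlinarith
  have h4 := abs_lt_of_sq_lt_sq h3 (by positivity)
  have h5 := (abs_lt.1 h4).2
  nlinarith

/-- Twisted conjugation by `x`, a product of invertible vectors, maps vectors to vectors, and
preserves or reverses the time orientation according to the sign of the scalar `c` obtained by
multiplying `x` with its reversal. -/
lemma exists_spinorNorm {x : Cl n} (hx : x ∈ lipschitz n) :
    ∃ c : ℝ, c ≠ 0 ∧ x * reverse x = c • (1 : Cl n) ∧
      ∀ v : Fin (n + 1) → ℝ, ∃ v', involute x * vec v = vec v' * x ∧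
        (IsFuture v → 0 < c * v' (Fin.last n)) := by
  obtain ⟨u, hu, rfl⟩ := hx
  change u ∈ lipschitzGroup (lorentzForm n) at hu
  simp only [Units.coeHom_apply]
  have hvec : ∀ w : Fin (n + 1) → ℝ, lorentzInner w w ≠ 0 →
      ∃ c : ℝ, c ≠ 0 ∧ vec w * reverse (vec w) = c • (1 : Cl n) ∧
      ∀ v : Fin (n + 1) → ℝ, ∃ v', involute (vec w) * vec v = vec v' * vec w ∧
        (IsFuture v → 0 < c * v' (Fin.last n)) := by
    intro w hw
    refine ⟨lorentzInner w w, hw, by rw [reverse_vec, vec_mul_self], fun v => ⟨_, ?_,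
      fun hv => hv.reflection_pos hw⟩⟩
    rw [involute_vec, neg_mul, neg_vec_mul_vec hw]
  have hunit : ∀ (x : (Cl n)ˣ) (w : Fin (n + 1) → ℝ), vec w = x →
      lorentzInner w w ≠ 0 ∧ ((x⁻¹ : (Cl n)ˣ) : Cl n) = vec ((lorentzInner w w)⁻¹ • w) := by
    intro x w hw
    have h0 : lorentzInner w w ≠ 0 := by
      intro h0
      have h1 := vec_mul_self w
      rw [h0, zero_smul, hw, ← Units.val_mul] at h1
      exact (x * x).ne_zero h1
    refine ⟨h0, ?_⟩
    refine Units.inv_eq_of_mul_eq_one_right ?_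
    rw [← hw, vec_smul, mul_smul_comm, vec_mul_self, smul_smul, inv_mul_cancel₀ h0, one_smul]
  induction hu using Subgroup.closure_induction'' with
  | mem x hx =>
    obtain ⟨w, hw⟩ := hx
    rw [← hw]
    exact hvec w (hunit x w hw).1
  | inv_mem x hx =>
    obtain ⟨w, hw⟩ := hx
    obtain ⟨h0, h1⟩ := hunit x w hw
    rw [h1]
    refine hvec _ ?_
    rw [lorentzInner_smul_left, lorentzInner_smul_right]
    exact mul_ne_zero (inv_ne_zero h0) (mul_ne_zero (inv_ne_zero h0) h0)
  | one =>
    refine ⟨1, one_ne_zero, by simp, fun v => ⟨v, by simp, fun hv => by simpa using hv.2⟩⟩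
  | mul x y _ _ hx hy =>
    obtain ⟨c, hc, hc', hx⟩ := hx
    obtain ⟨d, hd, hd', hy⟩ := hy
    refine ⟨c * d, mul_ne_zero hc hd, ?_, fun v => ?_⟩
    · rw [Units.val_mul, reverse.map_mul, mul_assoc, ← mul_assoc (y : Cl n), hd', smul_one_mul,
        mul_smul_comm, hc', smul_smul, mul_comm]
    · obtain ⟨v', hv', hf⟩ := hy v
      obtain ⟨w, hw, hfw⟩ := hx v'
      refine ⟨w, ?_, fun hv => ?_⟩
      · rw [Units.val_mul, map_mul, mul_assoc, hv', ← mul_assoc, hw, mul_assoc]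
      · -- `d • v'` is future-directed; apply the statement for `x` to it
        have hq := lorentzInner_eq_of_involute_mul (Units.mul_inv y) hv'
        have hfut : IsFuture (d • v') := by
          refine ⟨?_, hf hv⟩
          rw [lorentzInner_smul_left, lorentzInner_smul_right, hq, ← mul_assoc]
          exact mul_neg_of_pos_of_neg (mul_self_pos.2 hd) hv.1
        obtain ⟨z, hz, hfz⟩ := hx (d • v')
        have hzw : z = d • w := by
          apply vec_injective
          have h1 : vec z * (x : Cl n) = vec (d • w) * (x : Cl n) := by
            rw [← hz, vec_smul, vec_smul, mul_smul_comm, smul_mul_assoc, hw]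
          exact x.isUnit.mul_right_cancel h1
        have := hfz hfut
        rw [hzw, Pi.smul_apply, smul_eq_mul, ← mul_assoc] at this
        exact this

/-! ### The action on Minkowski space -/

/-- A linear left inverse of the inclusion of `ℝⁿ⁺¹` in the Clifford algebra. -/
def vecInv : Cl n →ₗ[ℝ] (Fin (n + 1) → ℝ) :=
  (LinearMap.exists_leftInverse_of_injective (ι (lorentzForm n))
    (LinearMap.ker_eq_bot.2 vec_injective)).choose

lemma vecInv_vec (v : Fin (n + 1) → ℝ) : vecInv (vec v) = v :=
  LinearMap.congr_fun (LinearMap.exists_leftInverse_of_injective (ι (lorentzForm n))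
    (LinearMap.ker_eq_bot.2 vec_injective)).choose_spec v

/-- The action of the spin group on `ℝⁿ⁺¹` by conjugation. -/
def act (g : G n) : (Fin (n + 1) → ℝ) →ₗ[ℝ] (Fin (n + 1) → ℝ) :=
  vecInv ∘ₗ LinearMap.mulLeftRight ℝ ((g : Cl n), ((g⁻¹ : G n) : Cl n)) ∘ₗ ι (lorentzForm n)

lemma act_apply (g : G n) (v : Fin (n + 1) → ℝ) :
    act g v = vecInv ((g : Cl n) * vec v * ((g⁻¹ : G n) : Cl n)) := rfl

lemma act_eq_of_mul_vec {g : G n} {v w : Fin (n + 1) → ℝ}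
    (h : (g : Cl n) * vec v = vec w * (g : Cl n)) : act g v = w := by
  rw [act_apply, h, mul_assoc, coe_mul_coe_inv, mul_one, vecInv_vec]

lemma coe_mul_vec (g : G n) (v : Fin (n + 1) → ℝ) :
    (g : Cl n) * vec v = vec (act g v) * (g : Cl n) := by
  obtain ⟨c, -, -, h⟩ := exists_spinorNorm g.2.1.1
  obtain ⟨v', hv', -⟩ := h v
  rw [spinGroup.involute_eq g.2] at hv'
  rw [act_eq_of_mul_vec hv', hv']

lemma act_mul (g h : G n) (v : Fin (n + 1) → ℝ) : act (g * h) v = act g (act h v) := by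
  apply act_eq_of_mul_vec
  change (g : Cl n) * (h : Cl n) * vec v = vec _ * ((g : Cl n) * (h : Cl n))
  rw [mul_assoc, coe_mul_vec, ← mul_assoc, coe_mul_vec, mul_assoc]

lemma act_one (v : Fin (n + 1) → ℝ) : act (1 : G n) v = v :=
  act_eq_of_mul_vec (by change (1 : Cl n) * _ = _ * 1; simp)

lemma act_inv_act (g : G n) (v : Fin (n + 1) → ℝ) : act g⁻¹ (act g v) = v := by
  rw [← act_mul, inv_mul_cancel, act_one]

lemma act_act_inv (g : G n) (v : Fin (n + 1) → ℝ) : act g (act g⁻¹ v) = v := by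
  rw [← act_mul, mul_inv_cancel, act_one]

lemma lorentzInner_act_self (g : G n) (v : Fin (n + 1) → ℝ) :
    lorentzInner (act g v) (act g v) = lorentzInner v v := by
  refine lorentzInner_eq_of_involute_mul (coe_mul_coe_inv g) ?_
  rw [spinGroup.involute_eq g.2, coe_mul_vec]

/-- Polarisation of the Lorentz form. -/
lemma two_mul_lorentzInner (u v : Fin (n + 1) → ℝ) :
    2 * lorentzInner u v = lorentzInner (u + v) (u + v) - lorentzInner u u - lorentzInner v v := by
  rw [lorentzInner_add_left, lorentzInner_add_right, lorentzInner_add_right, lorentzInner_comm v u]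
  ring

lemma lorentzInner_act (g : G n) (u v : Fin (n + 1) → ℝ) :
    lorentzInner (act g u) (act g v) = lorentzInner u v := by
  have h1 := two_mul_lorentzInner (act g u) (act g v)
  rw [← map_add, lorentzInner_act_self, lorentzInner_act_self, lorentzInner_act_self,
    ← two_mul_lorentzInner] at h1
  linarith

lemma lorentzInner_act_left (g : G n) (u v : Fin (n + 1) → ℝ) :
    lorentzInner (act g u) v = lorentzInner u (act g⁻¹ v) := by
  rw [← lorentzInner_act g⁻¹, act_inv_act]

lemma continuous_act (v : Fin (n + 1) → ℝ) : Continuous fun g : G n => act g v := by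
  have h : Continuous (vecInv : Cl n →ₗ[ℝ] (Fin (n + 1) → ℝ)) :=
    IsModuleTopology.continuous_of_linearMap _
  refine h.comp ((continuous_subtype_val.mul continuous_const).mul
    (continuous_subtype_val.comp continuous_inv))

/-- The timelike basis vector `eₙ₊₁`, the origin of hyperbolic space. -/
abbrev origin (n : ℕ) : Fin (n + 1) → ℝ := basisVec (Fin.last n)

lemma lorentzInner_origin (v : Fin (n + 1) → ℝ) : lorentzInner (origin n) v = - v (Fin.last n) :=
  lorentzInner_basisVec_last v

lemma lorentzInner_origin_self : lorentzInner (origin n) (origin n) = -1 := by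
  rw [lorentzInner_origin]; simp

lemma isFuture_origin : IsFuture (origin n) :=
  ⟨by rw [lorentzInner_origin_self]; norm_num, by simp⟩

lemma act_origin_last_pos (g : G n) : 0 < act g (origin n) (Fin.last n) := by
  obtain ⟨c, -, hc, h⟩ := exists_spinorNorm g.2.1.1
  obtain ⟨v', hv', hf⟩ := h (origin n)
  rw [← coe_inv_eq_reverse, coe_mul_coe_inv] at hc
  have hc1 : c = 1 := smul_one_injective (n := n) (by rw [← hc, one_smul])
  rw [spinGroup.involute_eq g.2] at hv'
  rw [act_eq_of_mul_vec hv']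
  simpa [hc1] using hf isFuture_origin

lemma mem_K_iff {k : G n} : k ∈ K n ↔ act k (origin n) = origin n := by
  constructor
  · intro h
    exact act_eq_of_mul_vec h
  · intro h
    have := coe_mul_vec k (origin n)
    rw [h] at this
    exact this

/-! ### Reflections -/

lemma reflect_of_lorentzInner_eq_zero {u v : Fin (n + 1) → ℝ} (h : lorentzInner u v = 0) :
    reflect u v = v := by simp [reflect, h]

lemma reflect_smul {c : ℝ} (hc : c ≠ 0) (u v : Fin (n + 1) → ℝ) :
    reflect (c • u) v = reflect u v := by
  simp only [reflect, lorentzInner_smul_left, lorentzInner_smul_right, smul_smul]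
  congr 2
  rcases eq_or_ne (lorentzInner u u) 0 with h | h
  · simp [h]
  · field_simp

lemma reflect_sub {v w : Fin (n + 1) → ℝ} (h : lorentzInner v v = lorentzInner w w)
    (hvw : lorentzInner (v - w) (v - w) ≠ 0) : reflect (v - w) v = w := by
  have h1 : 2 * lorentzInner (v - w) v = lorentzInner (v - w) (v - w) := by
    simp only [lorentzInner_sub_left, lorentzInner_sub_right, lorentzInner_comm w v]
    linarith
  rw [reflect, h1, div_self hvw, one_smul, sub_sub_cancel]

lemma act_rotor (u v : Fin (n + 1) → ℝ) (h : lorentzInner u u * lorentzInner v v = 1)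
    (w : Fin (n + 1) → ℝ) : act (rotor u v h) w = reflect u (reflect v w) := by
  apply act_eq_of_mul_vec
  change vec u * vec v * vec w = _ * (vec u * vec v)
  have h1 := neg_vec_mul_vec (left_ne_zero_of_mul_eq_one h) (reflect v w)
  have h2 := neg_vec_mul_vec (right_ne_zero_of_mul_eq_one h) w
  rw [← mul_assoc, ← h1, neg_mul, mul_assoc, mul_assoc, ← h2, mul_neg, neg_neg]

lemma lorentzInner_self_pos {a : Fin (n + 1) → ℝ} (h : a (Fin.last n) = 0) (ha : a ≠ 0) :
    0 < lorentzInner a a := by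
  rw [lorentzInner, h, mul_zero, sub_zero]
  refine Finset.sum_pos' (fun i _ => mul_self_nonneg _) ?_
  by_contra! hc
  apply ha
  ext i
  induction i using Fin.lastCases with
  | last => exact h
  | cast i =>
    have := hc i (Finset.mem_univ _)
    simpa using le_antisymm this (mul_self_nonneg _)

/-- The unit vector in direction `a`. -/
def normalize (a : Fin (n + 1) → ℝ) : Fin (n + 1) → ℝ := (√(lorentzInner a a))⁻¹ • a

lemma lorentzInner_normalize {a : Fin (n + 1) → ℝ} (h : 0 < lorentzInner a a) :
    lorentzInner (normalize a) (normalize a) = 1 := by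
  rw [normalize, lorentzInner_smul_left, lorentzInner_smul_right, ← mul_assoc, ← mul_inv,
    Real.mul_self_sqrt h.le, inv_mul_cancel₀ h.ne']

lemma reflect_normalize {a : Fin (n + 1) → ℝ} (h : 0 < lorentzInner a a)
    (v : Fin (n + 1) → ℝ) : reflect (normalize a) v = reflect a v :=
  reflect_smul (inv_ne_zero (Real.sqrt_ne_zero'.2 h)) a v

lemma normalize_last {a : Fin (n + 1) → ℝ} (h : a (Fin.last n) = 0) :
    normalize a (Fin.last n) = 0 := by simp [normalize, h]

/-! ### Transitivity of `K` on spheres -/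

lemma exists_orthogonal (hn : 2 ≤ n) (v : Fin (n + 1) → ℝ) :
    ∃ w : Fin (n + 1) → ℝ, w (Fin.last n) = 0 ∧ w ≠ 0 ∧ lorentzInner w v = 0 := by
  let i : Fin n := ⟨0, by omega⟩
  let j : Fin n := ⟨1, by omega⟩
  have hij : i.castSucc ≠ j.castSucc := by simp [i, j]
  have hi := (Fin.castSucc_ne_last i).symm
  have hj := (Fin.castSucc_ne_last j).symm
  by_cases h0 : v i.castSucc = 0
  · refine ⟨basisVec i.castSucc, by simp [hi], by simp, ?_⟩
    rw [lorentzInner_basisVec_castSucc, h0]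
  · refine ⟨v j.castSucc • basisVec i.castSucc - v i.castSucc • basisVec j.castSucc,
      by simp [hi, hj], fun h => h0 ?_, ?_⟩
    · have := congrFun h j.castSucc
      simpa [Pi.single_apply, hij.symm] using this
    · rw [lorentzInner_sub_left, lorentzInner_smul_left, lorentzInner_smul_left,
        lorentzInner_basisVec_castSucc, lorentzInner_basisVec_castSucc]
      ring

/-- The maximal compact subgroup acts transitively on the spheres of `eₙ₊₁^⊥`: a reflection takes
`u` to `v`, and a second one fixes `v` and restores the orientation. -/
lemma exists_mem_K_act_eq (hn : 2 ≤ n) {u v : Fin (n + 1) → ℝ} (hu : u (Fin.last n) = 0)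
    (hv : v (Fin.last n) = 0) (h : lorentzInner u u = lorentzInner v v) :
    ∃ k ∈ K n, act k u = v := by
  by_cases huv : u - v = 0
  · exact ⟨1, one_mem _, by rw [act_one, sub_eq_zero.1 huv]⟩
  obtain ⟨w, hw, hw0, hwv⟩ := exists_orthogonal hn v
  have ha' : (u - v) (Fin.last n) = 0 := by simp [hu, hv]
  have ha := lorentzInner_self_pos ha' huv
  have hw' := lorentzInner_self_pos hw hw0
  have hor : ∀ a : Fin (n + 1) → ℝ, a (Fin.last n) = 0 → reflect a (origin n) = origin n :=
    fun a h0 => reflect_of_lorentzInner_eq_zero (by rw [lorentzInner_comm, lorentzInner_origin, h0,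
      neg_zero])
  refine ⟨rotor (normalize w) (normalize (u - v))
    (by rw [lorentzInner_normalize ha, lorentzInner_normalize hw', one_mul]), ?_, ?_⟩
  · rw [mem_K_iff, act_rotor, reflect_normalize ha, reflect_normalize hw', hor _ ha', hor _ hw]
  · rw [act_rotor, reflect_normalize ha, reflect_normalize hw', reflect_sub h ha.ne',
      reflect_of_lorentzInner_eq_zero hwv]

/-- Every `x` lies in the same double coset of `K` as `x⁻¹`: the points `x · o` and `x⁻¹ · o` are at
the same distance from the origin `o`, so an element of `K` takes one to the other. -/
lemma exists_inv_eq_mul_mul (hn : 2 ≤ n) (x : G n) :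
    ∃ k₁ ∈ K n, ∃ k₂ ∈ K n, x⁻¹ = k₁ * x * k₂ := by
  set p := act x (origin n) with hp
  set p' := act x⁻¹ (origin n) with hp'
  have ht : p (Fin.last n) = p' (Fin.last n) := by
    have := lorentzInner_act_left x (origin n) (origin n)
    rw [← hp, ← hp', lorentzInner_comm, lorentzInner_origin, lorentzInner_origin] at this
    linarith
  have hpp : lorentzInner p p = lorentzInner p' p' := by
    rw [hp, hp', lorentzInner_act, lorentzInner_act]
  set t := p (Fin.last n)
  obtain ⟨k, hk, hkp⟩ := exists_mem_K_act_eq hn (u := p - t • origin n) (v := p' - t • origin n)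
    (by simp [t]) (by simp [ht]) (by
      simp only [lorentzInner_sub_left, lorentzInner_sub_right, lorentzInner_smul_left,
        lorentzInner_smul_right, lorentzInner_comm p (origin n),
        lorentzInner_comm p' (origin n), lorentzInner_origin, hpp, ← ht]
      rfl)
  have hk' := mem_K_iff.1 hk
  rw [map_sub, map_smul, hk', sub_left_inj] at hkp
  refine ⟨k, hk, (x * k * x)⁻¹, inv_mem (mem_K_iff.2 ?_), by group⟩
  rw [act_mul, act_mul, ← hp, hkp, hp', act_act_inv]

/-! ### Compactness of `K` -/

section
open scoped Pointwise

/-- The unit vectors orthogonal to `eₙ₊₁`, together with `1`, in the Clifford algebra. -/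
def unitVecs (n : ℕ) : Set (Cl n) :=
  insert 1 (vec '' {u | u (Fin.last n) = 0 ∧ lorentzInner u u = 1})

lemma isCompact_unitVecs : IsCompact (unitVecs n) := by
  refine IsCompact.insert (IsCompact.image ?_
    (IsModuleTopology.continuous_of_linearMap (ι (lorentzForm n)))) 1
  refine Metric.isCompact_of_isClosed_isBounded ?_ ?_
  · refine IsClosed.inter (isClosed_eq (continuous_apply _) continuous_const)
      (isClosed_eq ?_ continuous_const)
    simp only [lorentzInner]
    fun_prop
  · refine (Metric.isBounded_closedBall (x := (0 : Fin (n + 1) → ℝ)) (r := 1)).subset ?_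
    rintro u ⟨h0, h1⟩
    rw [mem_closedBall_zero_iff, pi_norm_le_iff_of_nonneg zero_le_one]
    intro i
    induction i using Fin.lastCases with
    | last => simp [h0]
    | cast i =>
      rw [lorentzInner, h0, mul_zero, sub_zero] at h1
      rw [Real.norm_eq_abs, ← sq_le_one_iff_abs_le_one, ← h1, sq]
      exact Finset.single_le_sum (f := fun i : Fin n => u i.castSucc * u i.castSucc)
        (fun i _ => mul_self_nonneg _) (Finset.mem_univ i)

lemma isCompact_unitVecs_pow (m : ℕ) : IsCompact (unitVecs n ^ m) := by
  induction m with
  | zero => rw [pow_zero]; exact isCompact_singleton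
  | succ m ih => rw [pow_succ]; exact ih.mul isCompact_unitVecs

lemma mem_unitVecs_pow {m : ℕ} {p : Cl n} (hp : p ∈ unitVecs n ^ m) :
    p ∈ lipschitz n ∧ p * reverse p = 1 := by
  induction m generalizing p with
  | zero =>
    rw [pow_zero, Set.mem_one] at hp
    rw [hp]
    exact ⟨one_mem _, by simp⟩
  | succ m ih =>
    rw [pow_succ] at hp
    obtain ⟨q, hq, r, hr, rfl⟩ := hp
    obtain ⟨h1, h2⟩ := ih hq
    have h3 : r ∈ lipschitz n ∧ r * reverse r = 1 := by
      rcases hr with rfl | ⟨u, hu, rfl⟩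
      · exact ⟨one_mem _, by simp⟩
      · exact ⟨vec_mem_lipschitz (by rw [hu.2]; exact one_ne_zero),
          by rw [reverse_vec, vec_mul_self, hu.2, one_smul]⟩
    refine ⟨mul_mem h1 h3.1, ?_⟩
    change q * r * reverse (q * r) = 1
    rw [reverse.map_mul, mul_assoc, ← mul_assoc r, h3.2, one_mul, h2]

lemma involute_vec_mul_mul_vec {u : Fin (n + 1) → ℝ} (hu : lorentzInner u u ≠ 0) {z : Cl n}
    {v v' : Fin (n + 1) → ℝ} (h : involute z * vec v = vec v' * z) :
    involute (vec u * z) * vec v = vec (reflect u v') * (vec u * z) := by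
  rw [map_mul, involute_vec, mul_assoc, h, ← mul_assoc, neg_mul, neg_vec_mul_vec hu, mul_assoc]

/-- Twisted conjugation by `z` preserves the Lorentz inner product. -/
lemma lorentzInner_eq_of_involute_mul_pair {z : Cl n} (hz : z ∈ lipschitz n)
    {v v' w w' : Fin (n + 1) → ℝ} (hv : involute z * vec v = vec v' * z)
    (hw : involute z * vec w = vec w' * z) : lorentzInner v' w' = lorentzInner v w := by
  obtain ⟨z, -, rfl⟩ := hz
  simp only [Units.coeHom_apply] at hv hw
  have hvw : involute (z : Cl n) * vec (v + w) = vec (v' + w') * (z : Cl n) := by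
    rw [vec_add, vec_add, mul_add, hv, hw, add_mul]
  have h1 := two_mul_lorentzInner v' w'
  rw [lorentzInner_eq_of_involute_mul (Units.mul_inv z) hv,
    lorentzInner_eq_of_involute_mul (Units.mul_inv z) hw,
    lorentzInner_eq_of_involute_mul (Units.mul_inv z) hvw, ← two_mul_lorentzInner] at h1
  linarith

/-- The Cartan-Dieudonné reduction: after splitting off `m` reflections in unit vectors
orthogonal to `eₙ₊₁`, an element fixing `eₙ₊₁` fixes the first `m` basis vectors too. -/
lemma exists_eq_mul_of_involute_mul_origin {x : Cl n} (hx : x ∈ lipschitz n)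
    (hxo : involute x * vec (origin n) = vec (origin n) * x) (m : ℕ) (hm : m ≤ n) :
    ∃ p ∈ unitVecs n ^ m, ∃ z ∈ lipschitz n, x = p * z ∧
      involute z * vec (origin n) = vec (origin n) * z ∧
      ∀ j : Fin n, (j : ℕ) < m →
        involute z * vec (basisVec j.castSucc) = vec (basisVec j.castSucc) * z := by
  induction m with
  | zero => exact ⟨1, by simp, x, hx, by simp, hxo, fun j hj => absurd hj (Nat.not_lt_zero _)⟩
  | succ m ih =>
    obtain ⟨p, hp, z, hz, rfl, hzo, hzj⟩ := ih (by omega)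
    let i : Fin n := ⟨m, by omega⟩
    obtain ⟨_, -, -, h⟩ := exists_spinorNorm hz
    obtain ⟨v, hv, -⟩ := h (basisVec i.castSucc)
    by_cases hvi : v - basisVec i.castSucc = 0
    · refine ⟨p, ?_, z, hz, rfl, hzo, fun j hj => ?_⟩
      · rw [pow_succ]
        exact ⟨p, hp, 1, Set.mem_insert _ _, mul_one p⟩
      · rcases Nat.lt_succ_iff_lt_or_eq.1 hj with hj | hj
        · exact hzj j hj
        · have hji : j = i := Fin.ext hj
          rw [hji, hv, sub_eq_zero.1 hvi]
    set a := v - basisVec i.castSucc with ha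
    have hvv : lorentzInner v v = lorentzInner (basisVec i.castSucc) (basisVec i.castSucc) :=
      lorentzInner_eq_of_involute_mul_pair hz hv hv
    have hao : lorentzInner a (origin n) = 0 := by
      rw [ha, lorentzInner_sub_left, lorentzInner_eq_of_involute_mul_pair hz hv hzo, sub_self]
    have haj : ∀ j : Fin n, (j : ℕ) < m → lorentzInner a (basisVec j.castSucc) = 0 := by
      intro j hj
      rw [ha, lorentzInner_sub_left, lorentzInner_eq_of_involute_mul_pair hz hv (hzj j hj), sub_self]
    have ha0 : a (Fin.last n) = 0 := by
      rw [lorentzInner_comm, lorentzInner_origin] at hao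
      linarith
    have hapos := lorentzInner_self_pos ha0 hvi
    have hu := lorentzInner_normalize hapos
    have hu0 : lorentzInner (normalize a) (normalize a) ≠ 0 := by rw [hu]; exact one_ne_zero
    have huu : vec (normalize a) * vec (normalize a) = (1 : Cl n) := by
      rw [vec_mul_self, hu, one_smul]
    refine ⟨p * vec (normalize a), ?_, vec (normalize a) * z,
      mul_mem (vec_mem_lipschitz hu0) hz, ?_, ?_, fun j hj => ?_⟩
    · rw [pow_succ]
      exact ⟨p, hp, _, Set.mem_insert_of_mem _ ⟨_, ⟨normalize_last ha0, hu⟩, rfl⟩, rfl⟩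
    · rw [mul_assoc, ← mul_assoc (vec _), huu, one_mul]
    · rw [involute_vec_mul_mul_vec hu0 hzo, reflect_normalize hapos,
        reflect_of_lorentzInner_eq_zero hao]
    · rcases Nat.lt_succ_iff_lt_or_eq.1 hj with hj | hj
      · rw [involute_vec_mul_mul_vec hu0 (hzj j hj), reflect_normalize hapos,
          reflect_of_lorentzInner_eq_zero (haj j hj)]
      · have hji : j = i := Fin.ext hj
        rw [hji, involute_vec_mul_mul_vec hu0 hv, reflect_normalize hapos,
          reflect_sub hvv hapos.ne']

/-- The elements of `K` are, up to sign, products of `n` elements of `unitVecs n`. -/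
lemma exists_eq_or_eq_neg_of_mem_K {k : G n} (hk : k ∈ K n) :
    ∃ p ∈ unitVecs n ^ n, (k : Cl n) = p ∨ (k : Cl n) = -p := by
  have hko : involute (k : Cl n) * vec (origin n) = vec (origin n) * (k : Cl n) := by
    rw [spinGroup.involute_eq k.2]; exact hk
  obtain ⟨p, hp, z, hz, hkz, hzo, hzj⟩ := exists_eq_mul_of_involute_mul_origin k.2.1.1 hko n le_rfl
  obtain ⟨c, rfl⟩ := exists_smul_one_of_involute_mul (x := z) (by
    intro i
    induction i using Fin.lastCases with
    | last => exact hzo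
    | cast j => exact hzj j j.2)
  have h1 := coe_mul_coe_inv k
  rw [mul_smul_comm, mul_one] at hkz
  rw [coe_inv_eq_reverse, hkz, map_smul, mul_smul_comm, smul_mul_assoc, (mem_unitVecs_pow hp).2,
    smul_smul] at h1
  have h2 : c * c = 1 := smul_one_injective (n := n) (by rw [h1, one_smul])
  refine ⟨p, hp, ?_⟩
  rcases mul_self_eq_one_iff.1 h2 with rfl | rfl
  · left; rw [hkz, one_smul]
  · right; rw [hkz, neg_smul, one_smul]

lemma neg_one_mem_lipschitz : (-1 : Cl n) ∈ lipschitz n := by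
  have h : lorentzInner (origin n) (origin n) ≠ 0 := by rw [lorentzInner_origin_self]; norm_num
  have := mul_mem (vec_mem_lipschitz h) (vec_mem_lipschitz h)
  rwa [vec_mul_self, lorentzInner_origin_self, neg_smul, one_smul] at this

/-- `K` is compact: as a subset of the Clifford algebra it is cut out, by closed conditions, from
the compact set of signed products of `n` elements of `unitVecs n`. -/
instance instCompactSpaceK : CompactSpace (K n) := by
  have hind : Topology.IsInducing (fun k : K n => ((k : G n) : Cl n)) :=
    Topology.IsInducing.subtypeVal.comp Topology.IsInducing.subtypeVal
  rw [← isCompact_univ_iff, hind.isCompact_iff, Set.image_univ]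
  have hclosed : IsClosed {x : Cl n | x ∈ CliffordAlgebra.even (lorentzForm n) ∧
      x * e n (Fin.last n) = e n (Fin.last n) * x} :=
    IsClosed.inter (Submodule.closed_of_finiteDimensional
      (Subalgebra.toSubmodule (CliffordAlgebra.even (lorentzForm n))))
      (isClosed_eq (by fun_prop) (by fun_prop))
  have hcomp := ((isCompact_unitVecs_pow (n := n) n).union
    (isCompact_unitVecs_pow (n := n) n).neg).inter_right hclosed
  convert hcomp using 1
  ext x
  constructor
  · rintro ⟨k, rfl⟩
    refine ⟨?_, (k : G n).2.2, k.2⟩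
    obtain ⟨p, hp, h | h⟩ := exists_eq_or_eq_neg_of_mem_K k.2
    · left; simpa only [h] using hp
    · right; simpa only [h, Set.mem_neg, neg_neg] using hp
  · rintro ⟨hx, heven, hcomm⟩
    have hx' : x ∈ lipschitz n ∧ x * reverse x = 1 := by
      rcases hx with hx | hx
      · exact mem_unitVecs_pow hx
      · obtain ⟨h1, h2⟩ := mem_unitVecs_pow hx
        refine ⟨?_, ?_⟩
        · have := mul_mem neg_one_mem_lipschitz h1
          rwa [neg_mul_neg, one_mul] at this
        · rwa [map_neg, neg_mul_neg] at h2
    exact ⟨⟨⟨x, mem_spinGroup hx'.1 heven hx'.2⟩, hcomm⟩, rfl⟩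

end

/-! ### The Iwasawa decomposition -/

lemma lorentzInner_basisVec_zero (hn : 2 ≤ n) (v : Fin (n + 1) → ℝ) :
    lorentzInner (basisVec 0) v = v 0 :=
  lorentzInner_basisVec_castSucc (⟨0, by omega⟩ : Fin n) v

lemma zero_ne_last (hn : 2 ≤ n) : (0 : Fin (n + 1)) ≠ Fin.last n := by
  simp [Fin.ext_iff]; omega

lemma e_last_mul_self : e n (Fin.last n) * e n (Fin.last n) = -1 := by
  rw [e_mul_self, lorentzInner_origin_self, neg_smul, one_smul]

lemma e_zero_mul_self (hn : 2 ≤ n) : e n 0 * e n 0 = 1 := by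
  have h : basisVec (0 : Fin (n + 1)) 0 = 1 := Pi.single_eq_same _ _
  rw [e_mul_self, lorentzInner_basisVec_zero hn, h, one_smul]

lemma e_zero_mul_e_last (hn : 2 ≤ n) :
    e n 0 * e n (Fin.last n) = -(e n (Fin.last n) * e n 0) :=
  e_mul_e_of_ne (zero_ne_last hn)

/-- The isotropic vector `e₁ + eₙ₊₁`, fixed by `N` and scaled by `exp 𝔞`. -/
def nullVec (n : ℕ) : Fin (n + 1) → ℝ := basisVec 0 + origin n

lemma vec_nullVec : vec (nullVec n) = e n 0 + e n (Fin.last n) := vec_add _ _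

lemma lorentzInner_nullVec (hn : 2 ≤ n) (v : Fin (n + 1) → ℝ) :
    lorentzInner (nullVec n) v = v 0 - v (Fin.last n) := by
  rw [nullVec, lorentzInner_add_left, lorentzInner_basisVec_zero hn, lorentzInner_origin]; ring

lemma nullVec_zero (hn : 2 ≤ n) : nullVec n 0 = 1 := by
  simp [nullVec, (zero_ne_last hn)]

lemma nullVec_last (hn : 2 ≤ n) : nullVec n (Fin.last n) = 1 := by
  simp [nullVec, (zero_ne_last hn).symm]

lemma lorentzInner_nullVec_self (hn : 2 ≤ n) : lorentzInner (nullVec n) (nullVec n) = 0 := by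
  rw [lorentzInner_nullVec hn, nullVec_zero hn, nullVec_last hn, sub_self]

lemma expA_eq (r : ℝ) : expA n r = Real.cosh (r / 2) • (1 : Cl n)
    + Real.sinh (r / 2) • (e n (Fin.last n) * e n 0) := by
  rw [expA, Algebra.algebraMap_eq_smul_one, Algebra.algebraMap_eq_smul_one, smul_one_mul]

lemma expA_mem_spinGroup (hn : 2 ≤ n) (r : ℝ) : expA n r ∈ spinGroup (lorentzForm n) := by
  have h : lorentzInner (origin n) (origin n) *
      lorentzInner (Real.sinh (r / 2) • basisVec 0 - Real.cosh (r / 2) • origin n)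
        (Real.sinh (r / 2) • basisVec 0 - Real.cosh (r / 2) • origin n) = 1 := by
    simp only [lorentzInner_sub_left, lorentzInner_sub_right, lorentzInner_smul_left,
      lorentzInner_smul_right, lorentzInner_origin_self, lorentzInner_basisVec_of_ne
      (zero_ne_last hn), lorentzInner_basisVec_of_ne (zero_ne_last hn).symm,
      lorentzInner_basisVec_zero hn, Pi.single_eq_same]
    have := Real.cosh_sq (r / 2)
    nlinarith
  convert (rotor _ _ h).2 using 1
  change _ = vec _ * vec _
  rw [vec_sub, vec_smul, vec_smul, vec_basisVec, vec_basisVec, mul_sub, mul_smul_comm,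
    mul_smul_comm, e_last_mul_self, expA_eq]
  module

/-- The element `expA n r` of `exp 𝔞`, as an element of `G`. -/
def elemA (hn : 2 ≤ n) (r : ℝ) : G n := ⟨expA n r, expA_mem_spinGroup hn r⟩

lemma act_elemA_nullVec (hn : 2 ≤ n) (r : ℝ) :
    act (elemA hn r) (nullVec n) = Real.exp r • nullVec n := by
  apply act_eq_of_mul_vec
  change expA n r * vec (nullVec n) = vec (Real.exp r • nullVec n) * expA n r
  have h1 : e n (Fin.last n) * e n 0 * e n 0 = e n (Fin.last n) := by
    rw [mul_assoc, e_zero_mul_self hn, mul_one]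
  have h2 : e n (Fin.last n) * e n 0 * e n (Fin.last n) = e n 0 := by
    rw [mul_assoc, e_zero_mul_e_last hn, mul_neg, ← mul_assoc, e_last_mul_self, neg_one_mul,
      neg_neg]
  have h3 : e n 0 * (e n (Fin.last n) * e n 0) = - e n (Fin.last n) := by
    rw [← mul_assoc, e_zero_mul_e_last hn, neg_mul, h1]
  have h4 : e n (Fin.last n) * (e n (Fin.last n) * e n 0) = - e n 0 := by
    rw [← mul_assoc, e_last_mul_self, neg_one_mul]
  have h5 : Real.exp r = Real.exp (r / 2) * Real.exp (r / 2) := by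
    rw [← Real.exp_add]; congr 1; ring
  have h6 : Real.exp r * (Real.cosh (r / 2) - Real.sinh (r / 2))
      = Real.cosh (r / 2) + Real.sinh (r / 2) := by
    rw [Real.cosh_sub_sinh, Real.cosh_add_sinh, h5, mul_assoc, ← Real.exp_add]; simp
  rw [vec_smul, vec_nullVec, expA_eq]
  simp only [mul_add, add_mul, smul_mul_assoc, mul_smul_comm, mul_one, one_mul, h1, h2, h3, h4]
  match_scalars <;> linarith

lemma act_elemA_boost (hn : 2 ≤ n) (r : ℝ) :
    act (elemA hn r) (Real.cosh r • origin n - Real.sinh r • basisVec 0) = origin n := by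
  apply act_eq_of_mul_vec
  change expA n r * vec _ = vec (origin n) * expA n r
  have h1 : e n (Fin.last n) * e n 0 * e n 0 = e n (Fin.last n) := by
    rw [mul_assoc, e_zero_mul_self hn, mul_one]
  have h2 : e n (Fin.last n) * e n 0 * e n (Fin.last n) = e n 0 := by
    rw [mul_assoc, e_zero_mul_e_last hn, mul_neg, ← mul_assoc, e_last_mul_self, neg_one_mul,
      neg_neg]
  have h4 : e n (Fin.last n) * (e n (Fin.last n) * e n 0) = - e n 0 := by
    rw [← mul_assoc, e_last_mul_self, neg_one_mul]
  have hc : Real.cosh r = Real.cosh (r / 2) ^ 2 + Real.sinh (r / 2) ^ 2 := by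
    rw [← Real.cosh_two_mul]; congr 1; ring
  have hs : Real.sinh r = 2 * Real.sinh (r / 2) * Real.cosh (r / 2) := by
    rw [← Real.sinh_two_mul]; congr 1; ring
  have h := Real.cosh_sq (r / 2)
  rw [vec_sub, vec_smul, vec_smul, vec_basisVec, vec_basisVec, expA_eq, hc, hs]
  simp only [mul_add, mul_sub, add_mul, smul_mul_assoc, mul_smul_comm, mul_one, one_mul, h1, h2,
    h4]
  match_scalars
  · linear_combination Real.cosh (r / 2) * h
  · linear_combination -Real.sinh (r / 2) * h

lemma expN_eq (v : Fin (n + 1) → ℝ) : expN n v = 1 + vec (nullVec n) * vec v := by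
  rw [expN, vec_nullVec]

lemma lorentzInner_nullVec_of_eq_zero (hn : 2 ≤ n) {v : Fin (n + 1) → ℝ} (h0 : v 0 = 0)
    (h1 : v (Fin.last n) = 0) : lorentzInner (nullVec n) v = 0 := by
  rw [lorentzInner_nullVec hn, h0, h1, sub_self]

lemma expN_mem_spinGroup (hn : 2 ≤ n) {v : Fin (n + 1) → ℝ} (h0 : v 0 = 0)
    (h1 : v (Fin.last n) = 0) : expN n v ∈ spinGroup (lorentzForm n) := by
  rcases eq_or_ne v 0 with rfl | hv
  · have h : vec (0 : Fin (n + 1) → ℝ) = 0 := map_zero _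
    rw [expN_eq, h, mul_zero, add_zero]
    exact one_mem _
  have hq := (lorentzInner_self_pos h1 hv).ne'
  have h : lorentzInner ((lorentzInner v v)⁻¹ • v + nullVec n)
      ((lorentzInner v v)⁻¹ • v + nullVec n) * lorentzInner v v = 1 := by
    simp only [lorentzInner_add_left, lorentzInner_add_right, lorentzInner_smul_left,
      lorentzInner_smul_right, lorentzInner_comm v (nullVec n),
      lorentzInner_nullVec_of_eq_zero hn h0 h1, lorentzInner_nullVec_self hn]
    field_simp
    ring
  convert (rotor _ _ h).2 using 1
  change _ = vec _ * vec _
  rw [vec_add, vec_smul, add_mul, smul_mul_assoc, vec_mul_self, smul_smul, inv_mul_cancel₀ hq,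
    one_smul, expN_eq]

/-- The element `expN n v` of `N`, as an element of `G`. -/
def elemN (hn : 2 ≤ n) {v : Fin (n + 1) → ℝ} (h0 : v 0 = 0) (h1 : v (Fin.last n) = 0) : G n :=
  ⟨expN n v, expN_mem_spinGroup hn h0 h1⟩

lemma vec_nullVec_mul_self (hn : 2 ≤ n) : vec (nullVec n) * vec (nullVec n) = 0 := by
  rw [vec_mul_self, lorentzInner_nullVec_self hn, zero_smul]

lemma vec_nullVec_mul_vec_mul (hn : 2 ≤ n) {v : Fin (n + 1) → ℝ} (h0 : v 0 = 0)
    (h1 : v (Fin.last n) = 0) : vec (nullVec n) * vec v * vec (nullVec n) = 0 := by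
  rw [mul_assoc, vec_mul_swap, lorentzInner_comm, lorentzInner_nullVec_of_eq_zero hn h0 h1,
    mul_zero, zero_smul, zero_sub, mul_neg, ← mul_assoc, vec_nullVec_mul_self hn, zero_mul,
    neg_zero]

lemma act_elemN_nullVec (hn : 2 ≤ n) {v : Fin (n + 1) → ℝ} (h0 : v 0 = 0)
    (h1 : v (Fin.last n) = 0) : act (elemN hn h0 h1) (nullVec n) = nullVec n := by
  apply act_eq_of_mul_vec
  change expN n v * _ = _ * expN n v
  rw [expN_eq, add_mul, vec_nullVec_mul_vec_mul hn h0 h1, mul_add, ← mul_assoc,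
    vec_nullVec_mul_self hn]
  simp

/-- The action of `N` on the vectors orthogonal to its parameter, solved for the argument. -/
lemma act_elemN (hn : 2 ≤ n) {v : Fin (n + 1) → ℝ} (h0 : v 0 = 0)
    (h1 : v (Fin.last n) = 0) {x : Fin (n + 1) → ℝ} (hxv : lorentzInner v x = 0) {s : ℝ}
    (hs : lorentzInner x (nullVec n) = -s) :
    act (elemN hn h0 h1) (x + (2 * s) • (lorentzInner v v • nullVec n - v)) = x := by
  apply act_eq_of_mul_vec
  change expN n v * _ = _ * expN n v
  have e1 : vec v * vec x = - (vec x * vec v) := by rw [vec_mul_swap, hxv]; simp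
  have e2 : vec x * vec (nullVec n)
      = (-(2 * s)) • (1 : Cl n) - vec (nullVec n) * vec x := by
    rw [vec_mul_swap, hs]; congr 2; ring
  have e3 : vec (nullVec n) * vec v * vec v = lorentzInner v v • vec (nullVec n) := by
    rw [mul_assoc, vec_mul_self, mul_smul_comm, mul_one]
  have e4 : vec (nullVec n) * vec v * vec x = -(vec (nullVec n) * vec x * vec v) := by
    rw [mul_assoc, e1, mul_neg, mul_assoc]
  rw [expN_eq, vec_add, vec_smul, vec_sub, vec_smul, mul_add (vec x), ← mul_assoc (vec x), e2]
  simp only [add_mul, mul_add, mul_sub, sub_mul, mul_smul_comm, smul_mul_assoc, one_mul, mul_one,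
    e3, e4, vec_nullVec_mul_vec_mul hn h0 h1]
  module

lemma act_origin_sub_pos (hn : 2 ≤ n) (g : G n) :
    0 < act g (origin n) (Fin.last n) - act g (origin n) 0 := by
  have h1 := act_origin_last_pos g
  have h2 := lorentzInner_act_self g (origin n)
  set p := act g (origin n)
  rw [lorentzInner_origin_self, lorentzInner] at h2
  have h3 : p 0 * p 0 ≤ ∑ i : Fin n, p i.castSucc * p i.castSucc :=
    Finset.single_le_sum (f := fun i : Fin n => p i.castSucc * p i.castSucc)
      (fun i _ => mul_self_nonneg _) (Finset.mem_univ (⟨0, by omega⟩ : Fin n))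
  have h4 : p 0 ^ 2 < p (Fin.last n) ^ 2 := by nlinarith
  linarith [(abs_lt.1 (abs_lt_of_sq_lt_sq h4 h1.le)).2]

/-- Existence of the Iwasawa decomposition. The factors in `exp 𝔞` and `N` are found by solving
`(a n)⁻¹ · o = g⁻¹ · o` for the origin `o`. -/
lemma exists_iwasawa (hn : 2 ≤ n) (g : G n) : ∃ k ∈ K n, ∃ (r : ℝ) (v : Fin (n + 1) → ℝ)
    (h0 : v 0 = 0) (h1 : v (Fin.last n) = 0), g = k * elemA hn r * elemN hn h0 h1 := by
  set p := act g⁻¹ (origin n) with hp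
  have hs : 0 < p (Fin.last n) - p 0 := act_origin_sub_pos hn g⁻¹
  have hpp : lorentzInner p p = -1 := by rw [hp, lorentzInner_act_self, lorentzInner_origin_self]
  -- `s` is `exp r`, and `u` below is the component of `p` orthogonal to `e₁` and `eₙ₊₁`
  set s := p (Fin.last n) - p 0 with hsdef
  have hl := zero_ne_last hn
  set u : Fin (n + 1) → ℝ := p - p 0 • basisVec 0 - p (Fin.last n) • origin n with hu
  have huu : lorentzInner u u = -1 + p (Fin.last n) ^ 2 - p 0 ^ 2 := by
    simp only [hu, lorentzInner_sub_left, lorentzInner_sub_right, lorentzInner_smul_left,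
      lorentzInner_smul_right, lorentzInner_comm p, lorentzInner_basisVec_zero hn,
      lorentzInner_origin, Pi.single_eq_same, Pi.single_eq_of_ne hl, Pi.single_eq_of_ne hl.symm,
      hpp]
    ring
  set v : Fin (n + 1) → ℝ := (-(1 / (2 * s))) • u with hv
  have h0 : v 0 = 0 := by simp [hv, hu, hl]
  have h1 : v (Fin.last n) = 0 := by simp [hv, hu, hl.symm]
  have hvv : lorentzInner v v = (-1 + p (Fin.last n) ^ 2 - p 0 ^ 2) / (4 * s ^ 2) := by
    rw [hv, lorentzInner_smul_left, lorentzInner_smul_right, huu]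
    field_simp
    ring
  set x : Fin (n + 1) → ℝ :=
    Real.cosh (Real.log s) • origin n - Real.sinh (Real.log s) • basisVec 0 with hx
  have hxv : lorentzInner v x = 0 := by
    rw [lorentzInner_comm, hx, lorentzInner_sub_left, lorentzInner_smul_left,
      lorentzInner_smul_left, lorentzInner_origin, lorentzInner_basisVec_zero hn, h0, h1]
    ring
  have hxs : lorentzInner x (nullVec n) = -s := by
    rw [hx, lorentzInner_sub_left, lorentzInner_smul_left, lorentzInner_smul_left,
      lorentzInner_origin, lorentzInner_basisVec_zero hn, nullVec_zero hn, nullVec_last hn]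
    have := Real.cosh_add_sinh (Real.log s)
    rw [Real.exp_log hs] at this
    linarith
  have hc : Real.cosh (Real.log s) = (s + s⁻¹) / 2 := Real.cosh_log hs
  have hsh : Real.sinh (Real.log s) = (s - s⁻¹) / 2 := Real.sinh_log hs
  have hpx : p = x + (2 * s) • (lorentzInner v v • nullVec n - v) := by
    have hid : p = u + p 0 • basisVec 0 + p (Fin.last n) • origin n := by rw [hu]; abel
    have hpn : p (Fin.last n) = s + p 0 := by rw [hsdef]; ring
    conv_lhs => rw [hid]
    rw [hvv, hx, hv, hc, hsh, nullVec, hpn]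
    match_scalars
    · field_simp
    · field_simp
      ring
    · field_simp
      ring
  have hN := act_elemN hn h0 h1 hxv hxs
  rw [← hpx] at hN
  refine ⟨g * (elemA hn (Real.log s) * elemN hn h0 h1)⁻¹, mem_K_iff.2 ?_, Real.log s, v, h0, h1,
    by group⟩
  have hA : act (elemA hn (Real.log s) * elemN hn h0 h1) p = origin n := by
    rw [act_mul, hN, hx, act_elemA_boost]
  rw [act_mul, ← hA, act_inv_act, hA, hp, act_act_inv]

/-- The height `-⟨g ξ, eₙ₊₁⟩` of the isotropic vector `g ξ`, which is `exp (H g)`. -/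
def height (g : G n) : ℝ := act g (nullVec n) (Fin.last n)

lemma continuous_height : Continuous (height : G n → ℝ) :=
  (continuous_apply _).comp (continuous_act _)

lemma height_of_mem_K (hn : 2 ≤ n) {k : G n} (hk : k ∈ K n) : height k = 1 := by
  have h1 := lorentzInner_act_left k (nullVec n) (origin n)
  rw [mem_K_iff.1 (inv_mem hk), lorentzInner_comm, lorentzInner_origin, lorentzInner_comm,
    lorentzInner_origin, nullVec_last hn] at h1
  rw [height]; linarith

/-- The cocycle property of the Iwasawa projection. -/
lemma height_mul (hn : 2 ≤ n) (g k : G n) (r : ℝ) {v : Fin (n + 1) → ℝ} (h0 : v 0 = 0)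
    (h1 : v (Fin.last n) = 0) :
    height (g * (k * elemA hn r * elemN hn h0 h1)) = Real.exp r * height (g * k) := by
  rw [height, act_mul, act_mul, act_mul, act_elemN_nullVec, act_elemA_nullVec, map_smul, map_smul,
    ← act_mul, Pi.smul_apply, smul_eq_mul, height]

lemma exp_H (hn : 2 ≤ n) (g : G n) : Real.exp (H n g) = height g := by
  have hex : ∃ r, IsIwasawa n g r := by
    obtain ⟨k, hk, r, v, h0, h1, hg⟩ := exists_iwasawa hn g
    exact ⟨r, k, hk, v, h0, h1, congrArg (Subtype.val : G n → Cl n) hg⟩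
  obtain ⟨k, hk, v, h0, h1, hg⟩ := Classical.epsilon_spec hex
  have hg' : g = 1 * (k * elemA hn (H n g) * elemN hn h0 h1) := by
    rw [one_mul]; exact Subtype.ext hg
  have h := height_mul hn 1 k (H n g) h0 h1
  rw [← hg', one_mul, height_of_mem_K hn hk, mul_one] at h
  exact h.symm

lemma height_pos (hn : 2 ≤ n) (g : G n) : 0 < height g := exp_H hn g ▸ Real.exp_pos _

lemma exists_height_mul (hn : 2 ≤ n) (y : G n) :
    ∃ k : K n, ∀ g : G n, height (g * y) = height y * height (g * (k : G n)) := by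
  obtain ⟨k, hk, r, v, h0, h1, rfl⟩ := exists_iwasawa hn y
  refine ⟨⟨k, hk⟩, fun g => ?_⟩
  have h := height_mul hn 1 k r h0 h1
  rw [one_mul, one_mul, height_of_mem_K hn hk, mul_one] at h
  rw [height_mul, h]

/-- The Iwasawa decomposition exhausts `G` by compact sets. -/
lemma sigmaCompactSpace_G (hn : 2 ≤ n) : SigmaCompactSpace (G n) := by
  let W := {v : Fin (n + 1) → ℝ // v 0 = 0 ∧ v (Fin.last n) = 0}
  have hW : IsClosed {v : Fin (n + 1) → ℝ | v 0 = 0 ∧ v (Fin.last n) = 0} :=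
    IsClosed.inter (isClosed_eq (continuous_apply _) continuous_const)
      (isClosed_eq (continuous_apply _) continuous_const)
  have : SigmaCompactSpace W := hW.isClosedEmbedding_subtypeVal.sigmaCompactSpace
  let f : K n × ℝ × W → G n := fun x => x.1 * elemA hn x.2.1 * elemN hn x.2.2.2.1 x.2.2.2.2
  have hA : Continuous (elemA hn) := by
    refine Continuous.subtype_mk (f := fun r => expA n r) ?_ _
    simp only [expA_eq]
    fun_prop
  have hvec : Continuous (vec : (Fin (n + 1) → ℝ) → Cl n) :=
    IsModuleTopology.continuous_of_linearMap (ι (lorentzForm n))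
  have hN : Continuous fun v : W => elemN hn v.2.1 v.2.2 := by
    refine Continuous.subtype_mk (f := fun v : W => expN n v.1) ?_ _
    simp only [expN_eq]
    exact continuous_const.add (continuous_const.mul (hvec.comp continuous_subtype_val))
  have hf : Continuous f :=
    ((continuous_subtype_val.comp continuous_fst).mul
      (hA.comp (continuous_fst.comp continuous_snd))).mul
      (hN.comp (continuous_snd.comp continuous_snd))
  have hsurj : Function.Surjective f := by
    intro g
    obtain ⟨k, hk, r, v, h0, h1, rfl⟩ := exists_iwasawa hn g
    exact ⟨⟨⟨k, hk⟩, r, ⟨v, h0, h1⟩⟩, rfl⟩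
  rw [← isSigmaCompact_univ_iff, ← hsurj.range_eq, ← Set.image_univ]
  exact isSigmaCompact_univ.image hf

/-! ### Schur's test and interpolation for positive kernels -/

section Kernel

variable {α : Type*} [MeasurableSpace α] {μ : Measure α}

/-- Schur's test with a weight `w` which is a common approximate eigenfunction of a positive kernel
and of its transpose. -/
lemma lintegral_sq_le_of_schur [SFinite μ] {k : α → α → ℝ≥0∞}
    (hk : AEMeasurable (Function.uncurry k) (μ.prod μ)) (hk' : ∀ x, AEMeasurable (k x) μ)
    {f w : α → ℝ≥0∞} (hf : AEMeasurable f μ) (hf1 : ∀ y, f y ≠ ∞)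
    (hw : Measurable w) (hw0 : ∀ x, w x ≠ 0)
    (hw1 : ∀ x, w x ≠ ∞) {N : ℝ≥0∞} (h1 : ∀ x, ∫⁻ y, k x y * w y ∂μ ≤ N * w x)
    (h2 : ∀ y, ∫⁻ x, k x y * w x ∂μ ≤ N * w y) :
    ∫⁻ x, (∫⁻ y, k x y * f y ∂μ) ^ (2 : ℝ) ∂μ ≤ N ^ (2 : ℝ) * ∫⁻ y, f y ^ (2 : ℝ) ∂μ := by
  have hpt : ∀ x, (∫⁻ y, k x y * f y ∂μ) ^ (2 : ℝ)
      ≤ N * ∫⁻ y, w x * (k x y * (f y ^ (2 : ℝ) * (w y)⁻¹)) ∂μ := by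
    intro x
    have hsplit : ∀ y, k x y * f y = (k x y * w y) ^ (1 / 2 : ℝ)
        * (k x y * (f y ^ (2 : ℝ) * (w y)⁻¹)) ^ (1 / 2 : ℝ) := by
      intro y
      rw [← ENNReal.mul_rpow_of_nonneg _ _ (by norm_num)]
      have : k x y * w y * (k x y * (f y ^ (2 : ℝ) * (w y)⁻¹)) = (k x y * f y) ^ (2 : ℝ) := by
        rw [ENNReal.mul_rpow_of_nonneg _ _ (by norm_num), ENNReal.rpow_two (k x y)]
        calc _ = k x y ^ 2 * f y ^ (2 : ℝ) * (w y * (w y)⁻¹) := by ring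
          _ = _ := by rw [ENNReal.mul_inv_cancel (hw0 y) (hw1 y), mul_one]
      rw [this, ← ENNReal.rpow_mul]
      norm_num
    simp_rw [hsplit]
    have hh := ENNReal.lintegral_mul_norm_pow_le (μ := μ) ((hk' x).mul hw.aemeasurable)
      ((hk' x).mul ((hf.pow_const (2 : ℝ)).mul hw.aemeasurable.inv))
      (p := 1 / 2) (q := 1 / 2) (by norm_num) (by norm_num) (by norm_num)
    refine (ENNReal.rpow_le_rpow hh (by norm_num : (0 : ℝ) ≤ 2)).trans ?_
    rw [ENNReal.mul_rpow_of_nonneg _ _ (by norm_num), ← ENNReal.rpow_mul, ← ENNReal.rpow_mul]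
    norm_num only [ENNReal.rpow_one]
    rw [lintegral_const_mul' _ _ (hw1 x)]
    simp only [Pi.mul_apply, Pi.inv_apply, ENNReal.rpow_ofNat]
    exact (mul_le_mul_left (h1 x) _).trans_eq (mul_assoc _ _ _)
  have hmeas : AEMeasurable (Function.uncurry fun x y =>
      w x * (k x y * (f y ^ (2 : ℝ) * (w y)⁻¹))) (μ.prod μ) :=
    hw.aemeasurable.comp_fst.mul
      (hk.mul ((hf.pow_const (2 : ℝ)).mul hw.aemeasurable.inv).comp_snd)
  calc ∫⁻ x, (∫⁻ y, k x y * f y ∂μ) ^ (2 : ℝ) ∂μ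
      ≤ ∫⁻ x, N * ∫⁻ y, w x * (k x y * (f y ^ (2 : ℝ) * (w y)⁻¹)) ∂μ ∂μ := lintegral_mono hpt
    _ = N * ∫⁻ x, ∫⁻ y, w x * (k x y * (f y ^ (2 : ℝ) * (w y)⁻¹)) ∂μ ∂μ :=
        lintegral_const_mul'' _ hmeas.lintegral_prod_right'
    _ = N * ∫⁻ y, ∫⁻ x, w x * (k x y * (f y ^ (2 : ℝ) * (w y)⁻¹)) ∂μ ∂μ := by
        rw [lintegral_lintegral_swap hmeas]
    _ ≤ N * ∫⁻ y, N * f y ^ (2 : ℝ) ∂μ := by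
        gcongr with y
        have hc : f y ^ (2 : ℝ) * (w y)⁻¹ ≠ ∞ :=
          ENNReal.mul_ne_top (ENNReal.rpow_ne_top_of_nonneg zero_le_two (hf1 y))
            (ENNReal.inv_ne_top.2 (hw0 y))
        calc ∫⁻ x, w x * (k x y * (f y ^ (2 : ℝ) * (w y)⁻¹)) ∂μ
            = (f y ^ (2 : ℝ) * (w y)⁻¹) * ∫⁻ x, k x y * w x ∂μ := by
              rw [← lintegral_const_mul' _ _ hc]
              exact lintegral_congr fun x => by ring
          _ ≤ (f y ^ (2 : ℝ) * (w y)⁻¹) * (N * w y) := mul_le_mul_right (h2 y) _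
          _ = N * f y ^ (2 : ℝ) * (w y * (w y)⁻¹) := by ring
          _ = N * f y ^ (2 : ℝ) := by rw [ENNReal.mul_inv_cancel (hw0 y) (hw1 y), mul_one]
    _ = N ^ (2 : ℝ) * ∫⁻ y, f y ^ (2 : ℝ) ∂μ := by
        rw [lintegral_const_mul'' _ (hf.pow_const _), ← mul_assoc, ENNReal.rpow_two, sq]

/-- Interpolation between the trivial `L¹ → L^∞` bound and the `L²` bound, by Hölder's inequality
for `k f = (k ^ (q / 2) f ^ (q' / 2)) ^ (2 / q) (f ^ q') ^ (1 - 2 / q)`. -/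
lemma lintegral_rpow_le_of_holder {k : α → α → ℝ≥0∞} (hk' : ∀ x, AEMeasurable (k x) μ)
    {f : α → ℝ≥0∞} (hf : AEMeasurable f μ) {q q' : ℝ} (hq : 2 ≤ q) (hqq' : q.HolderConjugate q')
    {N : ℝ≥0∞} (hN : ∫⁻ x, (∫⁻ y, k x y ^ (q / 2) * f y ^ (q' / 2) ∂μ) ^ (2 : ℝ) ∂μ
      ≤ N ^ (2 : ℝ) * ∫⁻ y, (f y ^ (q' / 2)) ^ (2 : ℝ) ∂μ) (hfin : ∫⁻ y, f y ^ q' ∂μ ≠ ∞) :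
    (∫⁻ x, (∫⁻ y, k x y * f y ∂μ) ^ q ∂μ) ^ (1 / q)
      ≤ (∫⁻ y, f y ^ q' ∂μ) ^ (1 / q') * N ^ (2 / q) := by
  have hq0 : 0 < q := by linarith
  have hq'0 : 0 < q' := hqq'.symm.pos
  have hexp : q' / 2 * (2 / q) + q' * (1 - 2 / q) = 1 := by
    have := hqq'.inv_add_inv_eq_one
    field_simp at this ⊢
    linarith
  have h2q : 0 ≤ 1 - 2 / q := by rw [sub_nonneg, div_le_one hq0]; exact hq
  set M := ∫⁻ y, f y ^ q' ∂μ
  have hpt : ∀ x, (∫⁻ y, k x y * f y ∂μ) ^ q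
      ≤ (∫⁻ y, k x y ^ (q / 2) * f y ^ (q' / 2) ∂μ) ^ (2 : ℝ) * M ^ (q - 2) := by
    intro x
    have hsplit : ∀ y, k x y * f y = (k x y ^ (q / 2) * f y ^ (q' / 2)) ^ (2 / q)
        * (f y ^ q') ^ (1 - 2 / q) := by
      intro y
      rw [ENNReal.mul_rpow_of_nonneg _ _ (by positivity), ← ENNReal.rpow_mul, ← ENNReal.rpow_mul,
        ← ENNReal.rpow_mul, mul_assoc, ← ENNReal.rpow_add_of_nonneg _ _ (by positivity)
        (by positivity), hexp, ENNReal.rpow_one]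
      congr 1
      rw [show q / 2 * (2 / q) = 1 by field_simp, ENNReal.rpow_one]
    simp_rw [hsplit]
    have hh := ENNReal.lintegral_mul_norm_pow_le (μ := μ)
      (((hk' x).pow_const (q / 2)).mul (hf.pow_const (q' / 2)))
      (hf.pow_const q') (p := 2 / q) (q := 1 - 2 / q) (by positivity) h2q (by ring)
    refine (ENNReal.rpow_le_rpow hh hq0.le).trans_eq ?_
    rw [ENNReal.mul_rpow_of_nonneg _ _ hq0.le, ← ENNReal.rpow_mul, ← ENNReal.rpow_mul]
    congr 2
    · field_simp
    · field_simp
  have hM : M ^ (q - 2) ≠ ∞ := ENNReal.rpow_ne_top_of_nonneg (by linarith) hfin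
  have h2 : ∫⁻ x, (∫⁻ y, k x y * f y ∂μ) ^ q ∂μ ≤ N ^ (2 : ℝ) * M ^ (q - 1) := by
    refine (lintegral_mono hpt).trans ?_
    rw [lintegral_mul_const' _ _ hM]
    refine (mul_le_mul_left hN _).trans_eq ?_
    simp_rw [← ENNReal.rpow_mul, div_mul_cancel₀ q' (two_ne_zero' ℝ)]
    rw [mul_assoc]
    congr 1
    nth_rewrite 1 [← ENNReal.rpow_one (∫⁻ y, f y ^ q' ∂μ)]
    rw [← ENNReal.rpow_add_of_nonneg _ _ zero_le_one (by linarith)]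
    congr 1; ring
  refine (ENNReal.rpow_le_rpow h2 (by positivity)).trans_eq ?_
  rw [ENNReal.mul_rpow_of_nonneg _ _ (by positivity), ← ENNReal.rpow_mul, ← ENNReal.rpow_mul,
    mul_comm]
  congr 2
  · have := hqq'.inv_add_inv_eq_one
    field_simp at this ⊢
    linarith
  · ring

end Kernel

/-! ### The kernels of radial convolutors -/

instance instSecondCountableG : SecondCountableTopology (G n) :=
  Topology.IsInducing.subtypeVal.secondCountableTopology

lemma sigmaFinite_of_isHaarMeasure (hn : 2 ≤ n) (μ : Measure (G n)) [μ.IsHaarMeasure] :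
    SigmaFinite μ := by
  have := sigmaCompactSpace_G hn
  exact ⟨⟨⟨compactCovering (G n), fun _ => trivial,
    fun i => (isCompact_compactCovering (G n) i).measure_lt_top, iUnion_compactCovering (G n)⟩⟩⟩

/-- The function `exp (-ρ H)` with `ρ = (n - 1) / 2`, whose average over `K` is `φ₀`. -/
def expRhoH (g : G n) : ℝ≥0∞ := ENNReal.ofReal (height g ^ (-(((n : ℝ) - 1) / 2)))

lemma measurable_expRhoH : Measurable (expRhoH : G n → ℝ≥0∞) :=
  (continuous_height.measurable.pow_const _).ennreal_ofReal

lemma expRhoH_ne_zero (hn : 2 ≤ n) (g : G n) : expRhoH g ≠ 0 := by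
  rw [expRhoH, Ne, ENNReal.ofReal_eq_zero, not_le]
  exact Real.rpow_pos_of_pos (height_pos hn g) _

lemma expRhoH_ne_top (g : G n) : expRhoH g ≠ ∞ := ENNReal.ofReal_ne_top

lemma exists_expRhoH_mul (hn : 2 ≤ n) (y : G n) :
    ∃ k : K n, ∀ g : G n, expRhoH (g * y) = expRhoH y * expRhoH (g * (k : G n)) := by
  obtain ⟨k, hk⟩ := exists_height_mul hn y
  refine ⟨k, fun g => ?_⟩
  rw [expRhoH, hk, Real.mul_rpow (height_pos hn _).le (height_pos hn _).le,
    ENNReal.ofReal_mul (Real.rpow_nonneg (height_pos hn _).le _), expRhoH, expRhoH]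

lemma height_mul_left {k : G n} (hk : k ∈ K n) (g : G n) : height (k * g) = height g := by
  have h := lorentzInner_act_left k (act g (nullVec n)) (origin n)
  rw [mem_K_iff.1 (inv_mem hk), lorentzInner_comm, lorentzInner_origin, lorentzInner_comm,
    lorentzInner_origin, ← act_mul] at h
  rw [height, height]; linarith

lemma ofReal_phi0 (hn : 2 ≤ n) (ν : Measure (K n)) [IsProbabilityMeasure ν] (x : G n) :
    ENNReal.ofReal (phi0 n ν x) = ∫⁻ k : K n, expRhoH (x * (k : G n)) ∂ν := by
  have h : ∀ k : K n, Real.exp (-(((n : ℝ) - 1) / 2) * H n (x * (k : G n)))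
      = height (x * (k : G n)) ^ (-(((n : ℝ) - 1) / 2)) := by
    intro k
    rw [mul_comm, Real.exp_mul, exp_H hn]
  have hcont : Continuous fun k : K n => height (x * (k : G n)) ^ (-(((n : ℝ) - 1) / 2)) :=
    (continuous_height.comp (continuous_const.mul continuous_subtype_val)).rpow_const
      fun k => Or.inl (height_pos hn _).ne'
  simp_rw [phi0, h]
  rw [ofReal_integral_eq_lintegral_ofReal (hcont.integrable_of_hasCompactSupport
    (HasCompactSupport.of_compactSpace _)) (ae_of_all _ fun k =>
      Real.rpow_nonneg (height_pos hn _).le _)]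
  rfl

/-- A function on `G` which is invariant under left and right translations by `K`. -/
def IsBiInvariant {β : Type*} (f : G n → β) : Prop :=
  ∀ (x : G n) (k₁ k₂ : K n), f ((k₁ : G n) * x * (k₂ : G n)) = f x

lemma IsBiInvariant.inv_eq {β : Type*} (hn : 2 ≤ n) {f : G n → β} (hf : IsBiInvariant f)
    (x : G n) : f x⁻¹ = f x := by
  obtain ⟨k₁, h₁, k₂, h₂, h⟩ := exists_inv_eq_mul_mul hn x
  rw [h]
  exact hf x ⟨k₁, h₁⟩ ⟨k₂, h₂⟩

lemma isBiInvariant_lintegral_expRhoH (ν : Measure (K n)) [ν.IsHaarMeasure] :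
    IsBiInvariant fun x : G n => ∫⁻ k : K n, expRhoH (x * (k : G n)) ∂ν := by
  intro x k₁ k₂
  simp only
  rw [← lintegral_mul_left_eq_self (fun k : K n => expRhoH (x * (k : G n))) k₂]
  refine lintegral_congr fun k => ?_
  rw [expRhoH, expRhoH, mul_assoc, mul_assoc, height_mul_left k₁.2, Subgroup.coe_mul]

/-- The spherical transform `∫ f φ₀` of a bi-invariant function `f` at the spectral parameter `0`
is the eigenvalue of convolution with `f` on translates of `exp (-ρ H)`. -/
lemma lintegral_inv_mul_expRhoH (hn : 2 ≤ n) (μ : Measure (G n)) [μ.IsHaarMeasure]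
    (ν : Measure (K n)) [ν.IsHaarMeasure] [IsProbabilityMeasure ν] {f : G n → ℝ≥0∞}
    (hf : AEMeasurable f μ) (hfK : IsBiInvariant f) (k : K n) :
    ∫⁻ z, f z⁻¹ * expRhoH (z⁻¹ * (k : G n)) ∂μ = ∫⁻ x, f x * ENNReal.ofReal (phi0 n ν x) ∂μ := by
  have := sigmaFinite_of_isHaarMeasure hn μ
  -- a translation of the integration variable moves `k` around, so the integral does not depend
  -- on `k` and may be averaged over `K`
  have hindep : ∀ k : K n, ∫⁻ z, f z⁻¹ * expRhoH (z⁻¹ * (k : G n)) ∂μ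
      = ∫⁻ z, f z⁻¹ * expRhoH z⁻¹ ∂μ := by
    intro k
    rw [← lintegral_mul_left_eq_self _ (k : G n)]
    refine lintegral_congr fun z => ?_
    have := hfK z⁻¹ 1 k⁻¹
    rw [mul_inv_rev, inv_mul_cancel_right]
    congr 1
    simpa using this
  have hmeas : AEMeasurable (Function.uncurry fun (z : G n) (k : K n) =>
      f z⁻¹ * expRhoH (z⁻¹ * (k : G n))) (μ.prod ν) := by
    refine (hf.comp_quasiMeasurePreserving (quasiMeasurePreserving_inv μ)).comp_fst.mul ?_
    refine (measurable_expRhoH.comp ?_).aemeasurable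
    exact (measurable_fst.inv).mul (measurable_subtype_coe.comp measurable_snd)
  calc ∫⁻ z, f z⁻¹ * expRhoH (z⁻¹ * (k : G n)) ∂μ
      = ∫⁻ k : K n, ∫⁻ z, f z⁻¹ * expRhoH (z⁻¹ * (k : G n)) ∂μ ∂ν := by
        simp_rw [hindep]
        simp
    _ = ∫⁻ z, ∫⁻ k : K n, f z⁻¹ * expRhoH (z⁻¹ * (k : G n)) ∂ν ∂μ :=
        (lintegral_lintegral_swap hmeas).symm
    _ = ∫⁻ x, f x * ENNReal.ofReal (phi0 n ν x) ∂μ := by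
        refine lintegral_congr fun z => ?_
        rw [lintegral_const_mul (f z⁻¹) (show Measurable fun k : K n => expRhoH (z⁻¹ * (k : G n)) from
          measurable_expRhoH.comp (measurable_const.mul measurable_subtype_coe)), hfK.inv_eq hn, ofReal_phi0 hn,
          (isBiInvariant_lintegral_expRhoH ν).inv_eq hn]

lemma quasiMeasurePreserving_inv_mul_const (hn : 2 ≤ n) (μ : Measure (G n)) [μ.IsHaarMeasure]
    (x : G n) : Measure.QuasiMeasurePreserving (fun y => y⁻¹ * x) μ μ := by
  have := sigmaFinite_of_isHaarMeasure hn μ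
  have h := (quasiMeasurePreserving_inv μ).comp
    (measurePreserving_mul_left μ x⁻¹).quasiMeasurePreserving
  convert h using 2 with y
  simp

/-- Herz's principle: convolution with a radial function `f ≥ 0` is bounded on `L²` by `∫ f φ₀`.
Schur's test applies with the weight `x ↦ exp (-ρ H(x⁻¹))`. -/
lemma lintegral_conv_sq_le (hn : 2 ≤ n) (μ : Measure (G n)) [μ.IsHaarMeasure]
    (ν : Measure (K n)) [ν.IsHaarMeasure] [IsProbabilityMeasure ν] {f g : G n → ℝ≥0∞}
    (hf : AEMeasurable f μ) (hfK : IsBiInvariant f) (hg : AEMeasurable g μ)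
    (hg1 : ∀ y, g y ≠ ∞) :
    ∫⁻ x, (∫⁻ y, f (y⁻¹ * x) * g y ∂μ) ^ (2 : ℝ) ∂μ
      ≤ (∫⁻ x, f x * ENNReal.ofReal (phi0 n ν x) ∂μ) ^ (2 : ℝ) * ∫⁻ y, g y ^ (2 : ℝ) ∂μ := by
  have := sigmaFinite_of_isHaarMeasure hn μ
  refine lintegral_sq_le_of_schur (k := fun x y => f (y⁻¹ * x))
    (hf.comp_quasiMeasurePreserving (quasiMeasurePreserving_inv_mul_swap μ μ))
    (fun x => hf.comp_quasiMeasurePreserving (quasiMeasurePreserving_inv_mul_const hn μ x)) hg hg1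
    (w := fun x => expRhoH x⁻¹) (measurable_expRhoH.comp measurable_inv)
    (fun x => expRhoH_ne_zero hn _) (fun x => expRhoH_ne_top _) (fun x => ?_) (fun y => ?_)
  · obtain ⟨k, hk⟩ := exists_expRhoH_mul hn x⁻¹
    rw [← lintegral_mul_left_eq_self _ x, ← lintegral_inv_mul_expRhoH hn μ ν hf hfK k, mul_comm,
      ← lintegral_const_mul' _ _ (expRhoH_ne_top _)]
    refine le_of_eq (lintegral_congr fun z => ?_)
    rw [mul_inv_rev, inv_mul_cancel_right, hk]
    ring
  · obtain ⟨k, hk⟩ := exists_expRhoH_mul hn y⁻¹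
    rw [← lintegral_mul_left_eq_self _ y, ← lintegral_inv_mul_expRhoH hn μ ν hf hfK k, mul_comm,
      ← lintegral_const_mul' _ _ (expRhoH_ne_top _)]
    refine le_of_eq (lintegral_congr fun z => ?_)
    rw [mul_inv_rev, inv_mul_cancel_left, hk, hfK.inv_eq hn]
    ring

/-! ### Convolution with vector-valued radial kernels -/

section Vector

variable {V : Type*} [NormedAddCommGroup V] [InnerProductSpace ℂ V]

lemma IsTauRadial.isBiInvariant_enorm {τ : K n →* (V ≃ₗᵢ[ℂ] V)} {κ : G n → (V →L[ℂ] V)}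
    (hκ : IsTauRadial τ κ) : IsBiInvariant fun x => ‖κ x‖ₑ := by
  have hle : ∀ (x : G n) (k₁ k₂ : K n), ‖κ ((k₁ : G n) * x * (k₂ : G n))‖ ≤ ‖κ x‖ := by
    intro x k₁ k₂
    refine ContinuousLinearMap.opNorm_le_bound _ (norm_nonneg _) fun w => ?_
    rw [hκ, LinearIsometryEquiv.norm_map]
    exact ((κ x).le_opNorm _).trans_eq (by rw [LinearIsometryEquiv.norm_map])
  intro x k₁ k₂
  simp only [← ofReal_norm]
  congr 1
  refine le_antisymm (hle x k₁ k₂) ?_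
  have h := hle ((k₁ : G n) * x * (k₂ : G n)) k₁⁻¹ k₂⁻¹
  have hx : ((k₁⁻¹ : K n) : G n) * ((k₁ : G n) * x * (k₂ : G n)) * ((k₂⁻¹ : K n) : G n) = x := by
    push_cast
    group
  rwa [hx] at h

lemma aestronglyMeasurable_conv_integrand [FiniteDimensional ℂ V] (hn : 2 ≤ n)
    (μ : Measure (G n)) [μ.IsHaarMeasure] {F : G n → V} {κ : G n → (V →L[ℂ] V)}
    (hF : AEStronglyMeasurable F μ) (hκ : AEStronglyMeasurable κ μ) (x : G n) :
    AEStronglyMeasurable (fun y => κ (y⁻¹ * x) (F y)) μ :=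
  isBoundedBilinearMap_apply.continuous.comp_aestronglyMeasurable
    ((hκ.comp_quasiMeasurePreserving (quasiMeasurePreserving_inv_mul_const hn μ x)).prodMk hF)

lemma aestronglyMeasurable_conv [FiniteDimensional ℂ V] (hn : 2 ≤ n)
    (μ : Measure (G n)) [μ.IsHaarMeasure] {F : G n → V} {κ : G n → (V →L[ℂ] V)}
    (hF : AEStronglyMeasurable F μ) (hκ : AEStronglyMeasurable κ μ) :
    AEStronglyMeasurable (conv μ F κ) μ := by
  have := sigmaFinite_of_isHaarMeasure hn μ
  have h : AEStronglyMeasurable (fun p : G n × G n => κ (p.2⁻¹ * p.1) (F p.2)) (μ.prod μ) :=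
    isBoundedBilinearMap_apply.continuous.comp_aestronglyMeasurable
      ((hκ.comp_quasiMeasurePreserving (quasiMeasurePreserving_inv_mul_swap μ μ)).prodMk
        hF.comp_snd)
  exact h.integral_prod_right'

lemma enorm_apply_le_mul (A : V →L[ℂ] V) (w : V) : ‖A w‖ₑ ≤ ‖A‖ₑ * ‖w‖ₑ := A.le_opENorm w

lemma enorm_conv_le (μ : Measure (G n)) (F : G n → V) (κ : G n → (V →L[ℂ] V)) (x : G n) :
    ‖conv μ F κ x‖ₑ ≤ ∫⁻ y, ‖κ (y⁻¹ * x)‖ₑ * ‖F y‖ₑ ∂μ :=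
  (enorm_integral_le_lintegral_enorm _).trans
    (lintegral_mono fun _ => enorm_apply_le_mul _ _)

lemma isTauType_conv [FiniteDimensional ℂ V] (τ : K n →* (V ≃ₗᵢ[ℂ] V)) (μ : Measure (G n))
    (F : G n → V) {κ : G n → (V →L[ℂ] V)} (hκ : IsTauRadial τ κ) : IsTauType τ (conv μ F κ) := by
  intro x k
  have h : ∀ y, κ (y⁻¹ * (x * (k : G n))) (F y) = (τ k)⁻¹ (κ (y⁻¹ * x) (F y)) := by
    intro y
    have := hκ (y⁻¹ * x) 1 k (F y)
    rw [map_one, inv_one] at this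
    simpa [mul_assoc] using this
  rw [conv, conv]
  simp_rw [h]
  exact (τ k)⁻¹.toContinuousLinearEquiv.integral_comp_comm _

/-- The endpoint `q = ∞`: convolution of an integrable function with a bounded one. -/
lemma lintegral_conv_le_of_top (hn : 2 ≤ n) (μ : Measure (G n)) [μ.IsHaarMeasure]
    (F : G n → V) {κ : G n → (V →L[ℂ] V)} (hκ : eLpNorm κ ∞ μ ≠ ∞) (x : G n) :
    ∫⁻ y, ‖κ (y⁻¹ * x)‖ₑ * ‖F y‖ₑ ∂μ ≤ eLpNorm F 1 μ * eLpNorm κ ∞ μ := by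
  rw [eLpNorm_exponent_top] at hκ ⊢
  rw [eLpNorm_one_eq_lintegral_enorm, mul_comm]
  have h := (quasiMeasurePreserving_inv_mul_const hn μ x).ae (enorm_ae_le_eLpNormEssSup κ μ)
  calc ∫⁻ y, ‖κ (y⁻¹ * x)‖ₑ * ‖F y‖ₑ ∂μ ≤ ∫⁻ y, eLpNormEssSup κ μ * ‖F y‖ₑ ∂μ := by
        refine lintegral_mono_ae ?_
        filter_upwards [h] with y hy
        gcongr
    _ = eLpNormEssSup κ μ * ∫⁻ y, ‖F y‖ₑ ∂μ := lintegral_const_mul' _ _ hκ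

/-- The estimate for finite `q`, for the convolution of the norms. -/
lemma lintegral_conv_rpow_le (hn : 2 ≤ n) (μ : Measure (G n)) [μ.IsHaarMeasure]
    (ν : Measure (K n)) [ν.IsHaarMeasure] [IsProbabilityMeasure ν] {q q' : ℝ≥0∞}
    (hq : 2 ≤ q) (hq_top : q ≠ ∞) (hqq' : q.HolderConjugate q')
    {τ : K n →* (V ≃ₗᵢ[ℂ] V)} {F : G n → V} {κ : G n → (V →L[ℂ] V)}
    (hF : MemLp F q' μ) (hκ : MemA τ μ ν q κ) :
    (∫⁻ x, (∫⁻ y, ‖κ (y⁻¹ * x)‖ₑ * ‖F y‖ₑ ∂μ) ^ q.toReal ∂μ) ^ (1 / q.toReal)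
      ≤ eLpNorm F q' μ * normA μ ν q κ := by
  have := sigmaFinite_of_isHaarMeasure hn μ
  have hq2 : 2 ≤ q.toReal := by
    have := ENNReal.toReal_mono hq_top hq
    simpa using this
  have hr : q.toReal.HolderConjugate q'.toReal :=
    ENNReal.HolderConjugate.toReal (by linarith)
  have hq'_top : q' ≠ ∞ := by
    rw [ENNReal.HolderConjugate.ne_top_iff_ne_one q' q]
    rintro rfl
    norm_num at hq2
  have hq'0 : q' ≠ 0 := ENNReal.HolderConjugate.ne_zero q' q
  have hκn : AEMeasurable (fun x => ‖κ x‖ₑ) μ := hκ.2.1.enorm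
  have hFn : AEMeasurable (fun x => ‖F x‖ₑ) μ := hF.1.enorm
  have hbi : IsBiInvariant fun x => ‖κ x‖ₑ ^ (q.toReal / 2) := fun x k₁ k₂ =>
    congrArg (· ^ (q.toReal / 2)) (hκ.1.isBiInvariant_enorm x k₁ k₂)
  have hfin : ∫⁻ y, ‖F y‖ₑ ^ q'.toReal ∂μ ≠ ∞ :=
    (lintegral_rpow_enorm_lt_top_of_eLpNorm_lt_top hq'0 hq'_top hF.2).ne
  have h := lintegral_rpow_le_of_holder (μ := μ) (k := fun x y => ‖κ (y⁻¹ * x)‖ₑ)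
    (fun x => hκn.comp_quasiMeasurePreserving (quasiMeasurePreserving_inv_mul_const hn μ x))
    hFn hq2 hr (lintegral_conv_sq_le hn μ ν (hκn.pow_const (q.toReal / 2)) hbi
      (hFn.pow_const (q'.toReal / 2)) fun y =>
        ENNReal.rpow_ne_top_of_nonneg (by positivity) enorm_ne_top) hfin
  rwa [normA, if_neg hq_top, eLpNorm_eq_lintegral_rpow_enorm_toReal hq'0 hq'_top]

end Vector

end SpinHyperbolic
end

theorem mainTheorem5 (n : ℕ) (hn : 2 ≤ n)
    {V : Type*} [NormedAddCommGroup V] [InnerProductSpace ℂ V] [FiniteDimensional ℂ V]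
    (τ : SpinHyperbolic.K n →* (V ≃ₗᵢ[ℂ] V)) (hτ : ∀ w : V, Continuous fun k => τ k w)
    (μ : Measure (SpinHyperbolic.G n)) [μ.IsHaarMeasure]
    (ν : Measure (SpinHyperbolic.K n)) [ν.IsHaarMeasure] [IsProbabilityMeasure ν]
    (q q' : ℝ≥0∞) (hq : 2 ≤ q) (hqq' : q.HolderConjugate q') :
    ∃ C : ℝ, 0 < C ∧
      ∀ (F : SpinHyperbolic.G n → V) (κ : SpinHyperbolic.G n → (V →L[ℂ] V)),
        SpinHyperbolic.MemLpTau τ μ q' F → SpinHyperbolic.MemA τ μ ν q κ →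
          (∀ᵐ x ∂μ, Integrable (fun y => κ (y⁻¹ * x) (F y)) μ) ∧
          SpinHyperbolic.MemLpTau τ μ q (SpinHyperbolic.conv μ F κ) ∧
          eLpNorm (SpinHyperbolic.conv μ F κ) q μ
            ≤ ENNReal.ofReal C * eLpNorm F q' μ * SpinHyperbolic.normA μ ν q κ := by
  refine ⟨1, one_pos, fun F κ hF hκ => ?_⟩
  have := SpinHyperbolic.sigmaFinite_of_isHaarMeasure hn μ
  rw [ENNReal.ofReal_one, one_mul]
  have hconv := SpinHyperbolic.aestronglyMeasurable_conv hn μ hF.2.1 hκ.2.1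
  have hfin : eLpNorm F q' μ * SpinHyperbolic.normA μ ν q κ < ∞ :=
    ENNReal.mul_lt_top hF.2.2 hκ.2.2
  have hint : ∀ x, ∫⁻ y, ‖κ (y⁻¹ * x)‖ₑ * ‖F y‖ₑ ∂μ < ∞ →
      Integrable (fun y => κ (y⁻¹ * x) (F y)) μ := fun x hx =>
    ⟨SpinHyperbolic.aestronglyMeasurable_conv_integrand hn μ hF.2.1 hκ.2.1 x,
      (lintegral_mono fun _ => SpinHyperbolic.enorm_apply_le_mul _ _).trans_lt hx⟩
  suffices h : (∀ᵐ x ∂μ, ∫⁻ y, ‖κ (y⁻¹ * x)‖ₑ * ‖F y‖ₑ ∂μ < ∞) ∧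
      eLpNorm (SpinHyperbolic.conv μ F κ) q μ
        ≤ eLpNorm F q' μ * SpinHyperbolic.normA μ ν q κ from
    ⟨h.1.mono hint, ⟨SpinHyperbolic.isTauType_conv τ μ F hκ.1, hconv, h.2.trans_lt hfin⟩, h.2⟩
  by_cases hq_top : q = ∞
  · have hq' : q' = 1 := (ENNReal.HolderConjugate.eq_top_iff_eq_one q q').1 hq_top
    subst hq_top hq'
    have hκ_fin := hκ.2.2
    rw [SpinHyperbolic.normA, if_pos rfl] at hfin hκ_fin ⊢
    have hle := SpinHyperbolic.lintegral_conv_le_of_top hn μ F hκ_fin.ne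
    refine ⟨ae_of_all _ fun x => (hle x).trans_lt hfin, ?_⟩
    rw [eLpNorm_exponent_top]
    exact eLpNormEssSup_le_of_ae_enorm_bound
      (ae_of_all _ fun x => (SpinHyperbolic.enorm_conv_le μ F κ x).trans (hle x))
  · have hle := SpinHyperbolic.lintegral_conv_rpow_le hn μ ν hq hq_top hqq' hF.2 hκ
    have hq0 : q ≠ 0 := (two_pos.trans_le hq).ne'
    have hqr : 0 < q.toReal := ENNReal.toReal_pos hq0 hq_top
    have hmeas : AEMeasurable (fun x => ∫⁻ y, ‖κ (y⁻¹ * x)‖ₑ * ‖F y‖ₑ ∂μ) μ :=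
      ((hκ.2.1.enorm.comp_quasiMeasurePreserving (quasiMeasurePreserving_inv_mul_swap μ μ)).mul
        hF.2.1.enorm.comp_snd).lintegral_prod_right'
    constructor
    · have h1 : ∫⁻ x, (∫⁻ y, ‖κ (y⁻¹ * x)‖ₑ * ‖F y‖ₑ ∂μ) ^ q.toReal ∂μ ≠ ∞ := fun htop => by
        rw [htop, ENNReal.top_rpow_of_pos (by positivity)] at hle
        exact (hle.trans_lt hfin).ne rfl
      refine (ae_lt_top' (hmeas.pow_const _) h1).mono fun x hx => ?_
      exact (ENNReal.rpow_lt_top_iff_of_pos hqr).1 hx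
    · rw [eLpNorm_eq_lintegral_rpow_enorm_toReal hq0 hq_top]
      refine le_trans ?_ hle
      gcongr with x
      exact SpinHyperbolic.enorm_conv_le μ F κ x
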